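/- Let $p$ be a prime, let $(\Lambda,Q)$ be a nondegenerate quadratic space over $\mathbb Z_p$ (that is, $\Lambda$ is a finitely generated free $\mathbb Z_p$-module and $Q$ is a quadratic form on $\Lambda$ whose polar form $B(x,y)=Q(x+y)-Q(x)-Q(y)$ is a perfect pairing), and let $O=O(Q)$ be its orthogonal group scheme. Choose algebraic closures $\overline{\mathbb Q}_p$, $\overline{\mathbb F}_p$ of $\mathbb Q_p$, $\mathbb F_p$. Let $\Gamma$ be a profinite group, let $\rho:\Gamma\to O(\mathbb Z_p)$ be a homomorphism with open kernel, and let $\rho_{\mathbb Q_p}:\Gamma\to O(\overline{\mathbb Q}_p)$ and $\rho_{\mathbb F_p}:\Gamma\to O(\overline{\mathbb F}_p)$ be the orthogonal representations obtained from it by extension of scalars. For an algebraically closed field $k$, a nondegenerate quadratic space $(V,Q)$ over $k$ and a homomorphism $\varphi:\Gamma\to O(Q)$ with open kernel, the Stiefel–Whitney class $SW(\varphi)=1+SW_1(\varphi)+SW_2(\varphi)\in 1+H^1(\Gamma,\mathbb F_2)+H^2(\Gamma,\mathbb F_2)$ (continuous cohomology) is defined as follows. Let $C(Q)$ be the Clifford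 algebra, and let the Clifford group $Cl(Q)$ be the group of homogeneous units $x$ of $C(Q)$ such that $y\mapsto(-1)^{\deg(x)\deg(y)}xyx^{-1}$ (for homogeneous $y$) preserves $V$; restriction of this automorphism to $V$ gives a surjection $Cl(Q)\to O(Q)$ with kernel $k^\times$, so that the degree on $Cl(Q)$ induces a homomorphism $\deg:O(Q)\to\mathbb F_2$. Then $SW_1(\varphi)$ is the class of $\deg\circ\varphi$. If the characteristic of $k$ is not $2$, let $\widetilde{\mathrm{Pin}}(Q)=\{x\in Cl(Q): x_t x=1\}$, where $x\mapsto x_t$ is the anti-involution of $C(Q)$ fixing all vectors; then $SW_2(\varphi)\in H^2(\Gamma,\mu_2(k))=H^2(\Gamma,\mathbb F_2)$ is the image of $\varphi$ under the connecting map of $1\to\mu_2(k)\to\widetilde{\mathrm{Pin}}(Q)\to O(Q)\to1$. If the characteristic of $k$ is $2$, then $SW_2(\varphi)=0$. The classes above are well defined for $\rho_{\mathbb Q_p}$ and $\rho_{\mathbb F_p}$, and the following holds. If $p\neq2$, then $SW(\rho_{\mathbb Q_p})=SW(\rho_{\mathbb F_p})$ in $1+H^1(\Gamma,\mathbb F_2)+H^2(\Gamma,\mathbb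 F_2)$. If $p=2$, then $SW_1(\rho_{\mathbb Q_p})=SW_1(\rho_{\mathbb F_p})$ in $H^1(\Gamma,\mathbb F_2)$. -/

import Mathlib

open scoped TensorProduct

namespace SWRed

/-! ### Quadratic spaces, orthogonal groups and base change -/

section Quadratic

variable {R : Type*} [CommRing R] {M : Type*} [AddCommGroup M] [Module R M]

/-- A quadratic form `Q` over `R` is nondegenerate when its polar form
`B (x, y) = Q (x + y) - Q x - Q y` is a perfect pairing, that is, when `x ↦ B (x, ·)` is an
isomorphism from `M` onto its dual. -/
def IsNondegenerate (Q : QuadraticForm R M) : Prop :=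
  Function.Bijective (Q.polarBilin : M →ₗ[R] Module.Dual R M)

/-- The group of `R`-points of the orthogonal group of the quadratic form `Q`. -/
def orthogonalGroup (Q : QuadraticForm R M) : Subgroup (M ≃ₗ[R] M) where
  carrier := {u | ∀ v, Q (u v) = Q v}
  mul_mem' := fun {a b} ha hb v => by
    rw [LinearEquiv.mul_apply, ha, hb]
  one_mem' := fun _ => rfl
  inv_mem' := fun {a} ha v => by
    have h := ha (a⁻¹ v)
    rw [← LinearEquiv.mul_apply, mul_inv_cancel] at h
    exact h.symm

variable (A : Type*) [CommRing A] [Algebra R A]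

theorem exists_extendScalars [Module.Free R M] (Q : QuadraticForm R M) :
    ∃ Q' : QuadraticForm A (A ⊗[R] M), ∀ m : M, Q' (1 ⊗ₜ[R] m) = algebraMap R A (Q m) := by
  obtain ⟨B, hB⟩ := LinearMap.BilinMap.toQuadraticMap_surjective Q
  refine ⟨(LinearMap.BilinForm.baseChange A B).toQuadraticMap, fun m => ?_⟩
  rw [LinearMap.BilinMap.toQuadraticMap_apply, LinearMap.BilinForm.baseChange_tmul, mul_one,
    ← hB, LinearMap.BilinMap.toQuadraticMap_apply, Algebra.algebraMap_eq_smul_one]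

/-- The quadratic form on `A ⊗ M` obtained from `Q` by extension of scalars from `R` to `A`: it is
the only quadratic form with `1 ⊗ m ↦ Q m` (`extendScalars_one_tmul`, `extendScalars_unique`). The
element `2` need not be invertible. -/
noncomputable def extendScalars [Module.Free R M] (Q : QuadraticForm R M) :
    QuadraticForm A (A ⊗[R] M) :=
  (exists_extendScalars A Q).choose

theorem extendScalars_one_tmul [Module.Free R M] (Q : QuadraticForm R M) (m : M) :
    extendScalars A Q (1 ⊗ₜ[R] m) = algebraMap R A (Q m) :=
  (exists_extendScalars A Q).choose_spec m

theorem extendScalars_unique [Module.Free R M] (Q : QuadraticForm R M)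
    (Q' : QuadraticForm A (A ⊗[R] M)) (h : ∀ m : M, Q' (1 ⊗ₜ[R] m) = algebraMap R A (Q m)) :
    Q' = extendScalars A Q :=
  baseChange_ext fun m => by rw [h, extendScalars_one_tmul]

/-- The homomorphism `O(Q)(R) → O(Q)(A)`, `u ↦ id_A ⊗ u`. -/
noncomputable def orthogonalMap [Module.Free R M] (Q : QuadraticForm R M) :
    orthogonalGroup Q →* orthogonalGroup (extendScalars A Q) where
  toFun u := ⟨LinearEquiv.baseChange R A M M u.1, fun v => by
    have h : (extendScalars A Q).comp (LinearEquiv.baseChange R A M M u.1).toLinearMap =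
        extendScalars A Q := by
      refine extendScalars_unique A Q _ fun m => ?_
      change extendScalars A Q (1 ⊗ₜ[R] (u.1 m)) = _
      rw [extendScalars_one_tmul, u.2]
    exact congrArg (fun q : QuadraticForm A (A ⊗[R] M) => q v) h⟩
  map_one' := by
    ext v
    induction v using TensorProduct.induction_on with
    | zero => simp
    | tmul a m => rfl
    | add x y hx hy => simp only [map_add, hx, hy]
  map_mul' u w := by
    ext v
    induction v using TensorProduct.induction_on with
    | zero => simp
    | tmul a m => rfl
    | add x y hx hy => simp only [map_add, hx, hy]

end Quadratic

/-! ### The Clifford group and the group `Pin~` -/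

section Clifford

variable {k : Type*} [Field k] {V : Type*} [AddCommGroup V] [Module k V]

/-- `x` is a homogeneous unit of degree `d` of the Clifford algebra, and the graded inner
automorphism `y ↦ (-1) ^ (deg x * deg y) x y x⁻¹` restricts to `u` on `V`. In other words, `x` is an
element of the Clifford group, of degree `d`, and its image in `O(Q)` is `u`. -/
def IsCliffordLift (Q : QuadraticForm k V) (d : ZMod 2) (x : (CliffordAlgebra Q)ˣ)
    (u : orthogonalGroup Q) : Prop :=
  (x : CliffordAlgebra Q) ∈ CliffordAlgebra.evenOdd Q d ∧
    ∀ v : V, (-1 : CliffordAlgebra Q) ^ d.val *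
      ((x : CliffordAlgebra Q) * CliffordAlgebra.ι Q v * (↑x⁻¹ : CliffordAlgebra Q)) =
        CliffordAlgebra.ι Q (u.1 v)

/-- The degree homomorphism `deg : O(Q) → 𝔽₂`, as a relation: `deg u = d` when `u` has a lift of
degree `d` to the Clifford group. -/
def HasDegree (Q : QuadraticForm k V) (u : orthogonalGroup Q) (d : ZMod 2) : Prop :=
  ∃ x : (CliffordAlgebra Q)ˣ, IsCliffordLift Q d x u

/-- `x` is an element of the group `Pin~` of `Q`, that is, an element of the Clifford group with
`N x = 1`, and its image in `O(Q)` is `u`. Here `N x = x_t * x`, where `x ↦ x_t` is the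
anti-involution of the Clifford algebra that fixes all vectors. -/
def IsPinLift (Q : QuadraticForm k V) (x : (CliffordAlgebra Q)ˣ) (u : orthogonalGroup Q) : Prop :=
  (∃ d : ZMod 2, IsCliffordLift Q d x u) ∧
    CliffordAlgebra.reverse (x : CliffordAlgebra Q) * (x : CliffordAlgebra Q) = 1

end Clifford

/-! ### Continuous cohomology with coefficients in `𝔽₂` -/

section Cohomology

universe u

instance continuousSMul_uliftZModTwo : ContinuousSMul (ZMod 2) (ULift.{u} (ZMod 2)) :=
  ⟨continuous_of_discreteTopology⟩

variable (Γ : Type u) [Group Γ] [TopologicalSpace Γ] [IsTopologicalGroup Γ]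

/-- The discrete group `𝔽₂` (lifted to the universe of `Γ`) with trivial action of `Γ`. -/
noncomputable abbrev trivialF₂ : TopRep.{u} (ZMod 2) Γ :=
  TopRep.of (ContRepresentation.trivial (ZMod 2) Γ (ULift.{u} (ZMod 2)))

/-- The continuous cohomology group `Hⁿ(Γ, 𝔽₂)`. -/
noncomputable abbrev H (n : ℕ) : TopModuleCat (ZMod 2) := continuousCohomology n (trivialF₂ Γ)

variable {Γ}

/-- The function `Γ × Γ → 𝔽₂` underlying a homogeneous 1-cochain. -/
def cochain₁ (f : (TopRep.homogeneousCochains (trivialF₂ Γ)).X 1) : C(Γ, C(Γ, ULift.{u} (ZMod 2))) :=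
  f.1

/-- The function `Γ × Γ × Γ → 𝔽₂` underlying a homogeneous 2-cochain. -/
def cochain₂ (f : (TopRep.homogeneousCochains (trivialF₂ Γ)).X 2) :
    C(Γ, C(Γ, C(Γ, ULift.{u} (ZMod 2)))) :=
  f.1

/-- The class `c` in `H¹(Γ, 𝔽₂)` is represented by the continuous inhomogeneous 1-cocycle `χ`, that
is, by the homogeneous cocycle `(g₀, g₁) ↦ χ (g₀⁻¹ g₁)`. -/
def Represents₁ (χ : Γ → ZMod 2) (c : H Γ 1) : Prop :=
  ∃ y : ContinuousCohomology.cocycles (trivialF₂ Γ) 1,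
    (∀ g₀ g₁, (cochain₁ (((TopRep.homogeneousCochains (trivialF₂ Γ)).iCycles 1).hom y) g₀ g₁).down =
      χ (g₀⁻¹ * g₁)) ∧
    (ContinuousCohomology.π (trivialF₂ Γ) 1).hom y = c

/-- The class `c` in `H²(Γ, 𝔽₂)` is represented by the continuous inhomogeneous 2-cocycle `z`, that
is, by the homogeneous cocycle `(g₀, g₁, g₂) ↦ z (g₀⁻¹ g₁, g₁⁻¹ g₂)`. -/
def Represents₂ (z : Γ → Γ → ZMod 2) (c : H Γ 2) : Prop :=
  ∃ y : ContinuousCohomology.cocycles (trivialF₂ Γ) 2,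
    (∀ g₀ g₁ g₂,
      (cochain₂ (((TopRep.homogeneousCochains (trivialF₂ Γ)).iCycles 2).hom y) g₀ g₁ g₂).down =
        z (g₀⁻¹ * g₁) (g₁⁻¹ * g₂)) ∧
    (ContinuousCohomology.π (trivialF₂ Γ) 2).hom y = c

/-! ### Stiefel-Whitney classes -/

variable {k : Type*} [Field k] {V : Type*} [AddCommGroup V] [Module k V]

/-- `SW₁(φ) = c`: the class `c` is represented by `deg ∘ φ`. -/
def IsSW₁ (Q : QuadraticForm k V) (φ : Γ →* orthogonalGroup Q) (c : H Γ 1) : Prop :=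
  ∃ χ : Γ → ZMod 2, (∀ σ, HasDegree Q (φ σ) (χ σ)) ∧ Represents₁ χ c

/-- `SW₂(φ) = c`. If the characteristic of `k` is not 2, this says that `c` is the image of `φ`
under the connecting map of `1 → μ₂ → Pin~ → O(Q) → 1` and `μ₂ = 𝔽₂`: for some continuous (that is,
locally constant) lifting `s` of `φ` to `Pin~`, the class `c` is represented by the 2-cocycle
`s σ * s τ * (s (σ τ))⁻¹`. In characteristic 2 the class `SW₂(φ)` is zero by definition. -/
def IsSW₂ (Q : QuadraticForm k V) (φ : Γ →* orthogonalGroup Q) (c : H Γ 2) : Prop :=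
  ((2 : k) ≠ 0 ∧ ∃ (s : Γ → (CliffordAlgebra Q)ˣ) (z : Γ → Γ → ZMod 2),
      IsLocallyConstant s ∧ (∀ σ, IsPinLift Q (s σ) (φ σ)) ∧
      (∀ σ τ, s σ * s τ * (s (σ * τ))⁻¹ = (-1) ^ (z σ τ).val) ∧ Represents₂ z c) ∨
    ((2 : k) = 0 ∧ c = 0)

/-- `SW(φ) = 1 + w.1 + w.2` in `1 + H¹(Γ, 𝔽₂) + H²(Γ, 𝔽₂)`. -/
def IsSW (Q : QuadraticForm k V) (φ : Γ →* orthogonalGroup Q) (w : H Γ 1 × H Γ 2) : Prop :=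
  IsSW₁ Q φ w.1 ∧ IsSW₂ Q φ w.2

end Cohomology

end SWRed

/-! Both representations come from one local domain `A` lying over `ℤ_p`: the localization at a
maximal ideal `m` of the integral closure of `ℤ_p` in `K`. It embeds in `K`, its residue field
embeds in `k`, and units of `A` have square roots because `K` is algebraically closed. Localizing at
`m` makes it unnecessary to know that `m` is the only maximal ideal.

The residue field of `A` is infinite, so every isometry over `A` is a product of reflections
(`reflectionSubgroup_eq_top`), also in residue characteristic 2. A reflection in `v` lifts to `v` in
the Clifford algebra, with spinor norm `Q v`; square roots of units normalize the norm of a product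
to 1. Thus each isometry over `ℤ_p` has a homogeneous lift over `A` of norm 1 (`exists_lifts`).

The graded centre of the Clifford algebra consists of scalars
(`exists_eq_algebraMap_of_supercommute`). Hence degrees are unique, lifts of norm 1 are unique up to
sign, and products of chosen lifts define a 2-cocycle `z` of signs. Pushing the lifts forward along
`A → K` and `A → k` preserves degree, norm and `z` (`IsGradedLift.changeScalars`), so the same
cochains compute the classes over both fields. For the second class the signs must stay distinct,
which requires `2 ≠ 0` in both fields; the first class has no such restriction. -/

namespace SWRed

/-! ### Contractions and the graded centre of the Clifford algebra -/

section Center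

open CliffordAlgebra

variable {R : Type*} [CommRing R] {M : Type*} [AddCommGroup M] [Module R M]

/-- The graded commutator with a vector `v` is the contraction with the functional `B (v, ·)`. -/
theorem ι_mul_sub_involute_mul_ι (Q : QuadraticForm R M) (v : M) (x : CliffordAlgebra Q) :
    ι Q v * x - involute x * ι Q v = contractLeft (Q.polarBilin v) x := by
  induction x using CliffordAlgebra.left_induction with
  | algebraMap r =>
    rw [contractLeft_algebraMap, AlgHom.commutes, Algebra.commutes, sub_self]
  | add x y hx hy => rw [map_add, map_add, mul_add, add_mul, ← hx, ← hy]; abel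
  | ι_mul x w hx =>
    rw [contractLeft_ι_mul, ← hx, map_mul, involute_ι, QuadraticMap.polarBilin_apply_apply,
      Algebra.smul_def, ← ι_mul_ι_add_swap]
    noncomm_ring

/-- Contraction is a graded derivation, and the term in which it hits `x` vanishes. Quantifying over
`y` lets the induction pass through products. -/
theorem contractLeft_mul_of_mem_adjoin {Q : QuadraticForm R M} {s : Set M} {d : Module.Dual R M}
    (hd : ∀ m ∈ s, d m = 0) {x : CliffordAlgebra Q} (hx : x ∈ Algebra.adjoin R (ι Q '' s)) :
    ∀ y : CliffordAlgebra Q, contractLeft d (x * y) = involute x * contractLeft d y := by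
  induction hx using Algebra.adjoin_induction with
  | mem x hx =>
    obtain ⟨m, hm, rfl⟩ := hx
    intro y
    rw [contractLeft_ι_mul, hd m hm, zero_smul, zero_sub, involute_ι, neg_mul]
  | algebraMap r => intro y; rw [contractLeft_algebraMap_mul, AlgHom.commutes]
  | add x x' _ _ hx hx' => intro y; rw [add_mul, map_add, map_add, hx, hx', add_mul]
  | mul x x' _ _ hx hx' => intro y; rw [mul_assoc, hx, hx', map_mul, mul_assoc]

theorem contractLeft_of_mem_adjoin {Q : QuadraticForm R M} {s : Set M} {d : Module.Dual R M}
    (hd : ∀ m ∈ s, d m = 0) {x : CliffordAlgebra Q} (hx : x ∈ Algebra.adjoin R (ι Q '' s)) :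
    contractLeft d x = 0 := by
  have h := contractLeft_mul_of_mem_adjoin hd hx 1
  rwa [mul_one, contractLeft_one, mul_zero] at h

/-- Left multiplication by any generator preserves the shape `a + e * b`, by the Clifford relations;
no basis of the Clifford algebra is needed. -/
theorem exists_add_ι_mul_of_mem_adjoin_insert {Q : QuadraticForm R M} {s : Set M} {e : M}
    {x : CliffordAlgebra Q} (hx : x ∈ Algebra.adjoin R (ι Q '' insert e s)) :
    ∃ a ∈ Algebra.adjoin R (ι Q '' s), ∃ b ∈ Algebra.adjoin R (ι Q '' s), x = a + ι Q e * b := by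
  set A := Algebra.adjoin R (ι Q '' s) with hA
  suffices h : ∀ y, (∃ a ∈ A, ∃ b ∈ A, y = a + ι Q e * b) →
      ∃ a ∈ A, ∃ b ∈ A, x * y = a + ι Q e * b by
    simpa using h 1 ⟨1, A.one_mem, 0, A.zero_mem, by simp⟩
  induction hx using Algebra.adjoin_induction with
  | mem x hx =>
    rintro _ ⟨a, ha, b, hb, rfl⟩
    obtain ⟨m, rfl | hm, rfl⟩ := hx
    · refine ⟨Q m • b, A.smul_mem hb _, a, ha, ?_⟩
      rw [mul_add, ← mul_assoc, ι_sq_scalar, Algebra.smul_def, add_comm]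
    · have hm' : ι Q m ∈ A := Algebra.subset_adjoin ⟨m, hm, rfl⟩
      refine ⟨ι Q m * a + QuadraticMap.polar Q m e • b,
        A.add_mem (A.mul_mem hm' ha) (A.smul_mem hb _), -(ι Q m * b),
        A.neg_mem (A.mul_mem hm' hb), ?_⟩
      rw [Algebra.smul_def, ← ι_mul_ι_add_swap]
      noncomm_ring
  | algebraMap r =>
    rintro _ ⟨a, ha, b, hb, rfl⟩
    refine ⟨r • a, A.smul_mem ha _, r • b, A.smul_mem hb _, ?_⟩
    rw [← Algebra.smul_def, smul_add, mul_smul_comm]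
  | add x x' _ _ hx hx' =>
    intro y hy
    obtain ⟨a, ha, b, hb, h⟩ := hx y hy
    obtain ⟨a', ha', b', hb', h'⟩ := hx' y hy
    refine ⟨a + a', A.add_mem ha ha', b + b', A.add_mem hb hb', ?_⟩
    rw [add_mul, h, h', mul_add]; abel
  | mul x x' _ _ hx hx' =>
    intro y hy
    rw [mul_assoc]
    exact hx _ (hx' y hy)

/-- An element of the Clifford algebra that is killed by all contractions is a scalar. -/
theorem mem_range_algebraMap_of_contractLeft_eq_zero [Module.Free R M] [Module.Finite R M]
    {Q : QuadraticForm R M} {x : CliffordAlgebra Q}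
    (hx : ∀ d : Module.Dual R M, contractLeft d x = 0) :
    ∃ r : R, x = algebraMap R (CliffordAlgebra Q) r := by
  classical
  let b := Module.Free.chooseBasis R M
  have key : ∀ s : Finset (Module.Free.ChooseBasisIndex R M),
      x ∈ Algebra.adjoin R (ι Q '' (b '' (s : Set _))) → ∃ r : R, x = algebraMap R _ r := by
    intro s
    induction s using Finset.induction_on with
    | empty =>
      intro h
      simp only [Finset.coe_empty, Set.image_empty, Algebra.adjoin_empty] at h
      obtain ⟨r, hr⟩ := Algebra.mem_bot.1 h
      exact ⟨r, hr.symm⟩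
    | insert i s hi ih =>
      intro h
      rw [Finset.coe_insert, Set.image_insert_eq] at h
      obtain ⟨a, ha, c, hc, hxac⟩ := exists_add_ι_mul_of_mem_adjoin_insert h
      have hd : ∀ m ∈ b '' (s : Set _), b.coord i m = 0 := by
        rintro _ ⟨j, hj, rfl⟩
        rw [Module.Basis.coord_apply, Module.Basis.repr_self, Finsupp.single_eq_of_ne]
        rintro rfl
        exact hi hj
      -- Contracting `a + b i * c` with the `i`-th coordinate kills `a` and returns `c`. So `c = 0`,
      -- and `x` involves one basis vector fewer.
      have h0 := hx (b.coord i)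
      rw [hxac, map_add, contractLeft_ι_mul, contractLeft_of_mem_adjoin hd ha,
        contractLeft_of_mem_adjoin hd hc, Module.Basis.coord_apply, Module.Basis.repr_self,
        Finsupp.single_eq_same, one_smul, mul_zero, sub_zero, zero_add] at h0
      rw [h0, mul_zero, add_zero] at hxac
      exact ih (hxac ▸ ha)
  refine key Finset.univ ?_
  have htop : Algebra.adjoin R (ι Q '' (b '' ↑(Finset.univ :
      Finset (Module.Free.ChooseBasisIndex R M)))) = ⊤ := by
    rw [eq_top_iff, ← CliffordAlgebra.adjoin_range_ι, Algebra.adjoin_le_iff]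
    rintro _ ⟨m, rfl⟩
    rw [← b.sum_repr m, map_sum]
    refine Subalgebra.sum_mem _ fun i _ => ?_
    rw [map_smul]
    exact Subalgebra.smul_mem _ (Algebra.subset_adjoin (Set.mem_image_of_mem _
      (Set.mem_image_of_mem _ (Finset.mem_coe.2 (Finset.mem_univ i))))) _
  rw [htop]
  trivial

theorem involute_of_mem_evenOdd {Q : QuadraticForm R M} {d : ZMod 2} {x : CliffordAlgebra Q}
    (hx : x ∈ evenOdd Q d) : involute x = (-1) ^ d.val * x := by
  fin_cases d
  · change involute x = (-1) ^ 0 * x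
    rw [involute_eq_of_mem_even hx, pow_zero, one_mul]
  · change involute x = (-1) ^ 1 * x
    rw [involute_eq_of_mem_odd hx, pow_one, neg_one_mul]

/-- The graded centre of the Clifford algebra of a nondegenerate form consists of the scalars. -/
theorem exists_eq_algebraMap_of_supercommute [Module.Free R M] [Module.Finite R M]
    {Q : QuadraticForm R M} (hQ : IsNondegenerate Q) {d : ZMod 2} {x : CliffordAlgebra Q}
    (hx : x ∈ evenOdd Q d) (hc : ∀ v, ι Q v * x = (-1) ^ d.val * (x * ι Q v)) :
    ∃ r : R, x = algebraMap R (CliffordAlgebra Q) r := by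
  refine mem_range_algebraMap_of_contractLeft_eq_zero fun δ => ?_
  -- By nondegeneracy every contraction is a graded commutator with some vector, and these vanish on
  -- `x`.
  obtain ⟨v, rfl⟩ := hQ.2 δ
  rw [← ι_mul_sub_involute_mul_ι, hc, involute_of_mem_evenOdd hx, mul_assoc, sub_self]

theorem eq_of_mem_evenOdd {Q : QuadraticForm R M} {d d' : ZMod 2} {x : CliffordAlgebra Q}
    (hx : x ∈ evenOdd Q d) (hx' : x ∈ evenOdd Q d') (h0 : x ≠ 0) : d = d' := by
  by_contra h
  exact h0 (Submodule.disjoint_def.1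
    ((DirectSum.Decomposition.isInternal (evenOdd Q)).submodule_iSupIndep.pairwiseDisjoint h)
    x hx hx')

end Center

/-! ### Generation of the orthogonal group by reflections -/

section Reflections

open QuadraticMap

variable {R : Type*} [CommRing R] {M : Type*} [AddCommGroup M] [Module R M]

theorem polar_orthogonal (Q : QuadraticForm R M) (u : orthogonalGroup Q) (x y : M) :
    polar Q (u.1 x) (u.1 y) = polar Q x y := by
  simp only [polar, ← map_add, u.2 _]

theorem map_sub_smul (Q : QuadraticForm R M) (x v : M) (a : R) :
    Q (x - a • v) = Q x + a * a * Q v - a * polar Q v x := by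
  rw [sub_eq_add_neg, ← neg_smul, QuadraticMap.map_add Q, QuadraticMap.map_smul,
    polar_smul_right, polar_comm Q x v, smul_eq_mul, smul_eq_mul]
  ring

/-- The reflection in a vector `v` such that `Q v` is a unit. -/
noncomputable def reflection (Q : QuadraticForm R M) (v : M) (hv : IsUnit (Q v)) :
    orthogonalGroup Q :=
  ⟨LinearEquiv.ofInvolutive
    (LinearMap.id - ((↑hv.unit⁻¹ : R) • Q.polarBilin v).smulRight v) fun x => by
      have h : (↑hv.unit⁻¹ : R) * Q v = 1 := hv.val_inv_mul
      simp only [LinearMap.sub_apply, LinearMap.id_apply, LinearMap.smulRight_apply,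
        LinearMap.smul_apply, polarBilin_apply_apply, smul_eq_mul, polar_sub_right,
        polar_smul_right, polar_self, nsmul_eq_mul, Nat.cast_ofNat]
      rw [sub_sub, ← add_smul, sub_eq_self]
      convert zero_smul R v using 2
      linear_combination (-2 * (↑hv.unit⁻¹ : R) * polar Q v x) * h, fun x => by
    have h : (↑hv.unit⁻¹ : R) * Q v = 1 := hv.val_inv_mul
    change Q (x - ((↑hv.unit⁻¹ : R) * polar Q v x) • v) = Q x
    rw [map_sub_smul]
    linear_combination ((↑hv.unit⁻¹ : R) * polar Q v x * polar Q v x) * h⟩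

theorem reflection_apply (Q : QuadraticForm R M) (v : M) (hv : IsUnit (Q v)) (x : M) :
    (reflection Q v hv).1 x = x - ((↑hv.unit⁻¹ : R) * polar Q v x) • v :=
  rfl

/-- The subgroup of the orthogonal group generated by the reflections. -/
def reflectionSubgroup (Q : QuadraticForm R M) : Subgroup (orthogonalGroup Q) :=
  Subgroup.closure {u | ∃ (v : M) (hv : IsUnit (Q v)), u = reflection Q v hv}

theorem reflection_mem (Q : QuadraticForm R M) (v : M) (hv : IsUnit (Q v)) :
    reflection Q v hv ∈ reflectionSubgroup Q :=
  Subgroup.subset_closure ⟨v, hv, rfl⟩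

theorem reflection_apply_of_polar_eq_zero (Q : QuadraticForm R M) {v : M} (hv : IsUnit (Q v))
    {z : M} (hz : polar Q v z = 0) : (reflection Q v hv).1 z = z := by
  rw [reflection_apply, hz, mul_zero, zero_smul, sub_zero]

theorem reflection_sub_apply (Q : QuadraticForm R M) {x y : M} (hxy : Q x = Q y)
    (hv : IsUnit (Q (x - y))) : (reflection Q (x - y) hv).1 x = y := by
  have h : polar Q (x - y) x = Q (x - y) := by
    have := map_sub_smul Q x y 1
    rw [one_smul] at this
    rw [polar_sub_left, polar_self, this, ← hxy, nsmul_eq_mul]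
    push_cast
    ring
  rw [reflection_apply, h, hv.val_inv_mul, one_smul, sub_sub_cancel]

section Local

variable [IsLocalRing R]

/-- A nondegenerate quadratic space over a local ring has a frame that is adapted to the successive
fixing of vectors by reflections. -/
theorem exists_adapted_frame [Module.Free R M] [Module.Finite R M] [Nontrivial M]
    {Q : QuadraticForm R M} (hQ : IsNondegenerate Q) :
    ∃ (i₀ : Module.Free.ChooseBasisIndex R M) (e g : Module.Free.ChooseBasisIndex R M → M),
      (∀ i j, i ≠ j → polar Q (g i) (e j) = 0) ∧ (∀ i, IsUnit (polar Q (g i) (e i))) ∧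
      IsUnit (Q (g i₀)) ∧ ∀ u : orthogonalGroup Q, (∀ i, u.1 (e i) = e i) → u = 1 := by
  classical
  let b := Module.Free.chooseBasis R M
  -- The family `e` is dual to the basis `b` for the polar form, so an isometry fixing all `e i`
  -- preserves all coordinates.
  choose e he using fun i => hQ.2 (b.coord i)
  have he' : ∀ i x, polar Q x (e i) = b.coord i x := fun i x => by
    rw [← he, polarBilin_apply_apply, polar_comm]
  have hb : ∀ i, b.coord i (b i) = 1 := fun i => by simp
  have hb' : ∀ i j, j ≠ i → b.coord i (b j) = 0 := fun i j h => by
    simp [Finsupp.single_eq_of_ne h.symm]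
  have hone : ∀ u : orthogonalGroup Q, (∀ i, u.1 (e i) = e i) → u = 1 := by
    intro u hu
    refine Subtype.ext (LinearEquiv.ext fun x => ?_)
    refine b.ext_elem fun i => ?_
    have h := polar_orthogonal Q u x (e i)
    rw [hu i, he', he'] at h
    exact h
  -- Since `1 = B (b i, e i)` is a combination of the `B (b i, b j)`, one of these is a unit. Then
  -- one of `Q (b i)`, `Q (b j)`, `Q (b i + b j)` is a unit.
  obtain ⟨i₀, f, hf, hfi⟩ : ∃ i₀ f, IsUnit (Q f) ∧ b.coord i₀ f = 1 := by
    have hne : Nonempty (Module.Free.ChooseBasisIndex R M) := inferInstance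
    obtain ⟨i⟩ := hne
    obtain ⟨j, hj⟩ : ∃ j, IsUnit (polar Q (b i) (b j)) := by
      by_contra! hall
      have h1 : polar Q (b i) (e i) = 1 := by rw [he', hb]
      rw [← b.sum_repr (e i), ← polarBilin_apply_apply, map_sum] at h1
      have h2 : (1 : R) ∈ IsLocalRing.maximalIdeal R := by
        rw [← h1]
        refine Ideal.sum_mem _ fun j _ => ?_
        rw [map_smul, smul_eq_mul, polarBilin_apply_apply]
        exact Ideal.mul_mem_left _ _ ((IsLocalRing.mem_maximalIdeal _).2 (hall j))
      exact (IsLocalRing.mem_maximalIdeal _).1 h2 isUnit_one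
    by_cases h1 : IsUnit (Q (b i))
    · exact ⟨i, b i, h1, hb i⟩
    by_cases h2 : IsUnit (Q (b j))
    · exact ⟨j, b j, h2, hb j⟩
    have hij : j ≠ i := by
      rintro rfl
      rw [polar_self, nsmul_eq_mul] at hj
      exact h1 (isUnit_of_mul_isUnit_right hj)
    refine ⟨i, b i + b j, ?_, by rw [map_add, hb, hb' i j hij, add_zero]⟩
    by_contra hc
    refine IsLocalRing.nonunits_add hc (mem_nonunits_iff.2 (mt (IsUnit.neg_iff _).1
      (IsLocalRing.nonunits_add h1 h2))) ?_
    rw [QuadraticMap.map_add Q, add_comm, neg_add_cancel_left]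
    exact hj
  -- Replacing `b i₀` by `f` spoils the duality; subtracting multiples of `e i₀` makes the other `e
  -- i` orthogonal to `f` again, because `f` has `i₀`-th coordinate 1.
  refine ⟨i₀, fun i => if i = i₀ then e i₀ else e i - b.coord i f • e i₀,
    fun i => if i = i₀ then f else b i, fun i j hij => ?_, fun i => ?_, by simpa using hf,
    fun u hu => hone u fun i => ?_⟩
  · by_cases hi : i = i₀ <;> by_cases hj : j = i₀
    · exact absurd (hi.trans hj.symm) hij
    · simp only [hi, hj, if_true, if_false, polar_sub_right, polar_smul_right, he', hfi,
        smul_eq_mul, mul_one, sub_self]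
    · simp only [hi, hj, if_true, if_false, he']
      exact hb' i₀ i hi
    · simp only [hi, hj, if_false, polar_sub_right, polar_smul_right, he', hb' _ _ hi,
        hb' _ _ hij, smul_zero, sub_zero]
  · by_cases hi : i = i₀
    · simp only [hi, if_true, he', hfi, isUnit_one]
    · simp only [hi, if_false, polar_sub_right, polar_smul_right, he', hb' _ _ hi, hb,
        smul_zero, sub_zero, isUnit_one]
  · have h0 : u.1 (e i₀) = e i₀ := by simpa using hu i₀
    by_cases hi : i = i₀
    · rw [hi, h0]
    · have := hu i
      simp only [hi, if_false, map_sub, map_smul, h0] at this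
      exact sub_left_injective this

variable [Infinite (IsLocalRing.ResidueField R)]

/-- A unit coefficient survives in the residue field, so the product of the three reductions is a
nonzero polynomial; over an infinite field it has a nonroot, which is then lifted. -/
theorem exists_isUnit_eval (p q r : Polynomial R) (hp : ∃ n, IsUnit (p.coeff n))
    (hq : ∃ n, IsUnit (q.coeff n)) (hr : ∃ n, IsUnit (r.coeff n)) :
    ∃ t : R, IsUnit (p.eval t) ∧ IsUnit (q.eval t) ∧ IsUnit (r.eval t) := by
  have hne : ∀ p : Polynomial R, (∃ n, IsUnit (p.coeff n)) →
      p.map (IsLocalRing.residue R) ≠ 0 := by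
    rintro p ⟨n, hn⟩ h0
    have h1 := congrArg (fun f => Polynomial.coeff f n) h0
    simp only [Polynomial.coeff_map, Polynomial.coeff_zero] at h1
    exact (hn.map (IsLocalRing.residue R)).ne_zero h1
  have hP := mul_ne_zero (mul_ne_zero (hne p hp) (hne q hq)) (hne r hr)
  obtain ⟨t, ht⟩ : ∃ t, Polynomial.eval t (p.map (IsLocalRing.residue R) *
      q.map (IsLocalRing.residue R) * r.map (IsLocalRing.residue R)) ≠ 0 := by
    by_contra! h
    exact hP (Polynomial.funext fun t => by rw [h t, Polynomial.eval_zero])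
  obtain ⟨t, rfl⟩ := IsLocalRing.residue_surjective t
  simp only [Polynomial.eval_mul, Polynomial.eval_map_apply, mul_ne_zero_iff,
    IsLocalRing.residue_ne_zero_iff_isUnit] at ht
  exact ⟨t, ht.1.1, ht.1.2, ht.2⟩

/-- All three quantities are polynomials in `t` with a unit coefficient, so a generic vector on the
line through `f` in direction `g` works. Used twice, it yields a `w` pairing to units with two given
vectors. -/
theorem exists_isUnit_polar (Q : QuadraticForm R M) {x y f g : M} (hf : IsUnit (Q f))
    (hx : IsUnit (polar Q f x) ∨ IsUnit (polar Q g x)) (hy : IsUnit (polar Q g y)) :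
    ∃ t : R, IsUnit (Q (f + t • g)) ∧ IsUnit (polar Q (f + t • g) x) ∧
      IsUnit (polar Q (f + t • g) y) := by
  open Polynomial in
  obtain ⟨t, h1, h2, h3⟩ := exists_isUnit_eval
    (C (Q f) + C (polar Q f g) * X + C (Q g) * X ^ 2)
    (C (polar Q f x) + C (polar Q g x) * X) (C (polar Q f y) + C (polar Q g y) * X)
    ⟨0, by simpa using hf⟩ (hx.elim (fun h => ⟨0, by simpa using h⟩) fun h => ⟨1, by simpa using h⟩)
    ⟨1, by simpa using hy⟩
  simp only [Polynomial.eval_add, Polynomial.eval_mul, Polynomial.eval_C, Polynomial.eval_X,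
    Polynomial.eval_pow] at h1 h2 h3
  refine ⟨t, ?_, ?_, ?_⟩
  · convert h1 using 1
    rw [QuadraticMap.map_add Q, QuadraticMap.map_smul, polar_smul_right, smul_eq_mul, smul_eq_mul]
    ring
  · convert h2 using 1
    rw [polar_add_left, polar_smul_left, smul_eq_mul, mul_comm t]
  · convert h3 using 1
    rw [polar_add_left, polar_smul_left, smul_eq_mul, mul_comm t]

/-- Two vectors of the same length and with the same products with the elements of `E` are moved
into each other by reflections fixing `E`, provided that the orthogonal complement of `E` is large
enough. -/
theorem exists_mem_reflectionSubgroup (Q : QuadraticForm R M) {E : Set M} {x y f g h : M}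
    (hxy : Q x = Q y) (hE : ∀ z ∈ E, polar Q x z = polar Q y z)
    (hf : IsUnit (Q f)) (hg : IsUnit (polar Q g x)) (hh : IsUnit (polar Q h y))
    (hfE : ∀ z ∈ E, polar Q f z = 0) (hgE : ∀ z ∈ E, polar Q g z = 0)
    (hhE : ∀ z ∈ E, polar Q h z = 0) :
    ∃ τ ∈ reflectionSubgroup Q, τ.1 x = y ∧ ∀ z ∈ E, τ.1 z = z := by
  have main : ∀ x', Q x' = Q y → (∀ z ∈ E, polar Q x' z = polar Q y z) → IsUnit (Q (x' - y)) →
      ∃ τ ∈ reflectionSubgroup Q, τ.1 x' = y ∧ ∀ z ∈ E, τ.1 z = z := fun x' h1 h2 h3 =>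
    ⟨_, reflection_mem Q _ h3, reflection_sub_apply Q h1 h3, fun z hz =>
      reflection_apply_of_polar_eq_zero Q h3 (by rw [polar_sub_left, h2 z hz, sub_self])⟩
  by_cases hu : IsUnit (Q (x - y))
  · exact main x hxy hE hu
  -- When `Q (x - y)` is not a unit, `x` is first reflected in a generic `w` orthogonal to `E`.
  obtain ⟨t, ht, htx, -⟩ := exists_isUnit_polar Q (x := x) hf (Or.inr hg) hg
  obtain ⟨s, hw, hwx, hwy⟩ := exists_isUnit_polar Q ht (Or.inl htx) hh
  set w := f + t • g + s • h with hwdef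
  have hwE : ∀ z ∈ E, polar Q w z = 0 := fun z hz => by
    simp [hwdef, polar_add_left, polar_smul_left, hfE z hz, hgE z hz, hhE z hz]
  have hfix : ∀ z ∈ E, (reflection Q w hw).1 z = z := fun z hz =>
    reflection_apply_of_polar_eq_zero Q hw (hwE z hz)
  obtain ⟨τ, hτ, hτx, hτE⟩ := main ((reflection Q w hw).1 x) (by rw [(reflection Q w hw).2, hxy])
    (fun z hz => by
      rw [← hE z hz, ← polar_orthogonal Q (reflection Q w hw) x z, hfix z hz]) (by
      -- The correction term is a unit and `Q (x - y)` is not, so in a local ring the sum is a unit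
      -- and a second reflection finishes.
      have key : Q ((reflection Q w hw).1 x - y) =
          Q (x - y) + ↑hw.unit⁻¹ * (polar Q w x * polar Q w y) := by
        have h1 : (↑hw.unit⁻¹ : R) * Q w = 1 := hw.val_inv_mul
        rw [reflection_apply, sub_right_comm, map_sub_smul, polar_sub_right]
        linear_combination ((↑hw.unit⁻¹ : R) * polar Q w x * polar Q w x) * h1
      by_contra hc
      refine IsLocalRing.nonunits_add hc ((mem_nonunits_iff).2 (mt (IsUnit.neg_iff _).1 hu)) ?_
      rw [key, add_comm, neg_add_cancel_left]
      exact hw.unit⁻¹.isUnit.mul (hwx.mul hwy))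
  refine ⟨τ * reflection Q w hw, mul_mem hτ (reflection_mem Q w hw), hτx, fun z hz => ?_⟩
  change τ.1 ((reflection Q w hw).1 z) = z
  rw [hfix z hz, hτE z hz]

/-- The theorem of Cartan and Dieudonné over a local ring with infinite residue field. -/
theorem reflectionSubgroup_eq_top [Module.Free R M] [Module.Finite R M]
    {Q : QuadraticForm R M} (hQ : IsNondegenerate Q) : reflectionSubgroup Q = ⊤ := by
  classical
  rw [eq_top_iff]
  intro u _
  cases subsingleton_or_nontrivial M with
  | inl hM =>
    have : u = 1 := Subtype.ext (LinearEquiv.ext fun x => Subsingleton.elim _ _)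
    exact this ▸ one_mem _
  | inr hM =>
    obtain ⟨i₀, e, g, hge, hge', hg, hone⟩ := exists_adapted_frame hQ
    -- `S` contains the indices of the frame vectors not yet known to be fixed. The index `i₀` is
    -- removed last, so that `g i₀`, of unit length, stays orthogonal to the fixed vectors
    -- throughout.
    suffices key : ∀ (n : ℕ) (S : Finset (Module.Free.ChooseBasisIndex R M)), S.card = n →
        (S.Nonempty → i₀ ∈ S) → ∀ u : orthogonalGroup Q, (∀ j, j ∉ S → u.1 (e j) = e j) →
        u ∈ reflectionSubgroup Q from
      key _ Finset.univ rfl (fun _ => Finset.mem_univ _) u fun j hj => absurd (Finset.mem_univ j) hj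
    intro n
    induction n with
    | zero =>
      intro S hS _ u hu
      rw [Finset.card_eq_zero] at hS
      rw [hone u fun j => hu j (by simp [hS])]
      exact one_mem _
    | succ n ih =>
      intro S hS hi₀ u hu
      have hne : S.Nonempty := Finset.card_pos.1 (by omega)
      obtain ⟨i, hi, hi'⟩ : ∃ i ∈ S, (S.erase i).Nonempty → i₀ ∈ S.erase i := by
        by_cases h : ∃ i ∈ S, i ≠ i₀
        · obtain ⟨i, hi, hii⟩ := h
          exact ⟨i, hi, fun _ => Finset.mem_erase.2 ⟨hii.symm, hi₀ hne⟩⟩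
        · push Not at h
          refine ⟨i₀, hi₀ hne, fun ⟨j, hj⟩ => ?_⟩
          exact absurd (h j (Finset.mem_of_mem_erase hj)) (Finset.ne_of_mem_erase hj)
      have hfix : ∀ z ∈ e '' {j | j ∉ S}, u.1 z = z := by
        rintro _ ⟨j, hj, rfl⟩
        exact hu j hj
      -- The vector `g i` pairs to a unit with `e i`, hence `u (g i)` does with `u (e i)`; both are
      -- orthogonal to the vectors already fixed, since `u` fixes these.
      obtain ⟨τ, hτ, hτx, hτE⟩ := exists_mem_reflectionSubgroup Q (E := e '' {j | j ∉ S})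
        (x := u.1 (e i)) (y := e i) (f := g i₀) (g := u.1 (g i)) (h := g i) (u.2 _)
        (fun z hz => by rw [← polar_orthogonal Q u (e i) z, hfix z hz]) hg
        (by rw [polar_orthogonal]; exact hge' i) (hge' i)
        (by rintro _ ⟨j, hj, rfl⟩; exact hge _ _ fun h => hj (h ▸ hi₀ hne))
        (by
          intro z hz
          rw [← hfix z hz, polar_orthogonal]
          obtain ⟨j, hj, rfl⟩ := hz
          exact hge _ _ fun h => hj (h ▸ hi))
        (by rintro _ ⟨j, hj, rfl⟩; exact hge _ _ fun h => hj (h ▸ hi))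
      rw [← Subgroup.mul_mem_cancel_left _ hτ]
      refine ih (S.erase i) (by rw [Finset.card_erase_of_mem hi, hS]; rfl) hi' _ fun j hj => ?_
      change τ.1 (u.1 (e j)) = e j
      by_cases hji : j = i
      · rw [hji, hτx]
      · have hjS : j ∉ S := fun h => hj (Finset.mem_erase.2 ⟨hji, h⟩)
        rw [hu j hjS, hτE _ ⟨j, hjS, rfl⟩]

end Local

end Reflections

/-! ### Homogeneous lifts to the Clifford group and spinor norms -/

section GradedLift

open CliffordAlgebra

variable {R : Type*} [CommRing R] {M : Type*} [AddCommGroup M] [Module R M]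

theorem neg_one_pow_val_add {A : Type*} [Monoid A] [HasDistribNeg A] (a b : ZMod 2) :
    (-1 : A) ^ (a + b).val = (-1) ^ a.val * (-1) ^ b.val := by
  rw [ZMod.val_add, ← pow_add]
  exact (pow_eq_pow_mod _ neg_one_sq).symm

theorem neg_one_pow_val_mul_self {A : Type*} [Monoid A] [HasDistribNeg A] (a : ZMod 2) :
    (-1 : A) ^ a.val * (-1) ^ a.val = 1 := by
  rw [← pow_add, Even.neg_one_pow ⟨_, rfl⟩]

theorem neg_one_pow_val_injective {A : Type*} [Monoid A] [HasDistribNeg A] (h : (-1 : A) ≠ 1) :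
    Function.Injective fun a : ZMod 2 => (-1 : A) ^ a.val := by
  have h' : (-1 : A) ^ (0 : ZMod 2).val ≠ (-1) ^ (1 : ZMod 2).val := by
    rw [ZMod.val_zero, ZMod.val_one, pow_zero, pow_one]
    exact h.symm
  intro a b hab
  fin_cases a <;> fin_cases b
  · rfl
  · exact absurd hab h'
  · exact absurd hab h'.symm
  · rfl

theorem commute_neg_one_pow {A : Type*} [Monoid A] [HasDistribNeg A] (n : ℕ) (x : A) : Commute ((-1 : A) ^ n) x :=
  (Commute.neg_one_left x).pow_left n

/-- The analogue of `IsCliffordLift` over a commutative ring. -/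
def IsGradedLift (Q : QuadraticForm R M) (d : ZMod 2) (x : (CliffordAlgebra Q)ˣ)
    (u : orthogonalGroup Q) : Prop :=
  (x : CliffordAlgebra Q) ∈ evenOdd Q d ∧
    ∀ v : M, (-1 : CliffordAlgebra Q) ^ d.val *
      ((x : CliffordAlgebra Q) * ι Q v * (↑x⁻¹ : CliffordAlgebra Q)) = ι Q (u.1 v)

variable {Q : QuadraticForm R M}

theorem isGradedLift_iff {d : ZMod 2} {x : (CliffordAlgebra Q)ˣ} {u : orthogonalGroup Q} :
    IsGradedLift Q d x u ↔ (x : CliffordAlgebra Q) ∈ evenOdd Q d ∧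
      ∀ v : M, ι Q (u.1 v) * x = (-1) ^ d.val * (x * ι Q v) := by
  refine and_congr_right fun _ => forall_congr' fun v => ?_
  rw [← mul_assoc, Units.mul_inv_eq_iff_eq_mul, eq_comm]

theorem IsGradedLift.mul {d d' : ZMod 2} {x y : (CliffordAlgebra Q)ˣ} {u w : orthogonalGroup Q}
    (hx : IsGradedLift Q d x u) (hy : IsGradedLift Q d' y w) :
    IsGradedLift Q (d + d') (x * y) (u * w) := by
  rw [isGradedLift_iff] at *
  refine ⟨SetLike.mul_mem_graded hx.1 hy.1, fun v => ?_⟩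
  change ι Q (u.1 (w.1 v)) * (x * y : CliffordAlgebra Q) = _ * (x * y * ι Q v)
  rw [← mul_assoc, hx.2, mul_assoc, mul_assoc, hy.2, neg_one_pow_val_add, mul_assoc,
    ← mul_assoc (x : CliffordAlgebra Q), ← (commute_neg_one_pow _ (x : CliffordAlgebra Q)).eq]
  simp only [mul_assoc]

/-- In degree 0, the equation `x * x⁻¹ = 1` says that the component of `x⁻¹` of degree `-d` is
already a right inverse of `x`. -/
theorem val_inv_mem_evenOdd {d : ZMod 2} {x : (CliffordAlgebra Q)ˣ}
    (hx : (x : CliffordAlgebra Q) ∈ evenOdd Q d) :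
    (↑x⁻¹ : CliffordAlgebra Q) ∈ evenOdd Q (-d) := by
  have h := DirectSum.coe_decompose_mul_add_of_left_mem (evenOdd Q) (j := -d)
    (b := (↑x⁻¹ : CliffordAlgebra Q)) hx
  rw [Units.mul_inv, add_neg_cancel, DirectSum.decompose_of_mem_same _
    (SetLike.GradedOne.one_mem (A := evenOdd Q))] at h
  rw [Units.inv_eq_of_mul_eq_one_right h.symm]
  exact Subtype.mem _

theorem IsGradedLift.inv {d : ZMod 2} {x : (CliffordAlgebra Q)ˣ} {u : orthogonalGroup Q}
    (hx : IsGradedLift Q d x u) : IsGradedLift Q (-d) x⁻¹ u⁻¹ := by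
  refine ⟨val_inv_mem_evenOdd hx.1, fun v => ?_⟩
  have h := (isGradedLift_iff.1 hx).2 (u⁻¹.1 v)
  have hv : u.1 (u⁻¹.1 v) = v := u.1.apply_symm_apply v
  rw [hv] at h
  rw [inv_inv, mul_assoc, h, ZMod.neg_eq_self_mod_two, ← mul_assoc (↑x⁻¹ : CliffordAlgebra Q),
    ← (commute_neg_one_pow d.val (↑x⁻¹ : CliffordAlgebra Q)).eq, mul_assoc, ← mul_assoc,
    neg_one_pow_val_mul_self, one_mul, Units.inv_mul_cancel_left]

/-- The kernel of the Clifford group acting on vectors consists of the scalars. -/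
theorem IsGradedLift.exists_eq_algebraMap [Module.Free R M] [Module.Finite R M]
    (hQ : IsNondegenerate Q) {d : ZMod 2} {x : (CliffordAlgebra Q)ˣ} (hx : IsGradedLift Q d x 1) :
    ∃ r : R, (x : CliffordAlgebra Q) = algebraMap R _ r :=
  exists_eq_algebraMap_of_supercommute hQ hx.1 (isGradedLift_iff.1 hx).2

/-- The quotient of two lifts lifts the identity, so it is a nonzero scalar, which has degree 0. -/
theorem IsGradedLift.degree_unique [Module.Free R M] [Module.Finite R M]
    [Nontrivial (CliffordAlgebra Q)] (hQ : IsNondegenerate Q) {d d' : ZMod 2}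
    {x y : (CliffordAlgebra Q)ˣ} {u : orthogonalGroup Q} (hx : IsGradedLift Q d x u)
    (hy : IsGradedLift Q d' y u) : d = d' := by
  have h := hx.mul hy.inv
  rw [mul_inv_cancel] at h
  obtain ⟨r, hr⟩ := h.exists_eq_algebraMap hQ
  have h0 := eq_of_mem_evenOdd h.1 (hr ▸ SetLike.algebraMap_mem_graded (evenOdd Q) r)
    (Units.ne_zero _)
  rwa [← sub_eq_add_neg, sub_eq_zero] at h0

theorem IsGradedLift.smul {d : ZMod 2} {x : (CliffordAlgebra Q)ˣ} {u : orthogonalGroup Q}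
    (hx : IsGradedLift Q d x u) (r : Rˣ) :
    IsGradedLift Q d (Units.map (algebraMap R (CliffordAlgebra Q)).toMonoidHom r * x) u := by
  rw [isGradedLift_iff] at *
  refine ⟨?_, fun v => ?_⟩
  · change algebraMap R (CliffordAlgebra Q) r * x ∈ _
    rw [← Algebra.smul_def]
    exact Submodule.smul_mem _ _ hx.1
  · change _ * (algebraMap R (CliffordAlgebra Q) r * x) =
      _ * (algebraMap R (CliffordAlgebra Q) r * x * _)
    rw [← Algebra.smul_def, mul_smul_comm, hx.2, smul_mul_assoc, mul_smul_comm]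

theorem isGradedLift_reflection (v : M) (hv : IsUnit (Q v)) :
    IsGradedLift Q 1 (isUnit_ι_of_isUnit Q hv).unit (reflection Q v hv) := by
  rw [isGradedLift_iff]
  refine ⟨ι_mem_evenOdd_one Q v, fun w => ?_⟩
  change _ * ι Q v = (-1) ^ 1 * (ι Q v * ι Q w)
  have h : (↑hv.unit⁻¹ : R) * Q v = 1 := hv.val_inv_mul
  rw [reflection_apply, map_sub, map_smul, sub_mul, smul_mul_assoc, ι_sq_scalar,
    Algebra.smul_def, ← map_mul (algebraMap R _), mul_right_comm, h, one_mul, ← ι_mul_ι_add_swap, pow_one,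
    neg_one_mul, sub_add_cancel_right]

/-- A vector of unit length lifts its own reflection, and the spinor norm is multiplicative because
its values are central. -/
theorem exists_isGradedLift {u : orthogonalGroup Q} (hu : u ∈ reflectionSubgroup Q) :
    ∃ (d : ZMod 2) (x : (CliffordAlgebra Q)ˣ) (r : Rˣ), IsGradedLift Q d x u ∧
      reverse (x : CliffordAlgebra Q) * x = algebraMap R (CliffordAlgebra Q) r := by
  induction hu using Subgroup.closure_induction with
  | mem u hu =>
    obtain ⟨v, hv, rfl⟩ := hu
    refine ⟨1, _, hv.unit, isGradedLift_reflection v hv, ?_⟩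
    change reverse (ι Q v) * ι Q v = _
    rw [reverse_ι, ι_sq_scalar]
    rfl
  | one =>
    refine ⟨0, 1, 1, ?_, by simp⟩
    rw [isGradedLift_iff]
    exact ⟨SetLike.GradedOne.one_mem (A := evenOdd Q), fun v => by
      rw [Units.val_one, ZMod.val_zero, pow_zero, one_mul, one_mul, mul_one]; rfl⟩
  | mul u w _ _ hu hw =>
    obtain ⟨d, x, r, hx, hr⟩ := hu
    obtain ⟨d', y, s, hy, hs⟩ := hw
    refine ⟨d + d', x * y, r * s, hx.mul hy, ?_⟩
    rw [Units.val_mul, reverse.map_mul, mul_assoc, ← mul_assoc (reverse (x : CliffordAlgebra Q)),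
      hr, ← mul_assoc, ← Algebra.commutes, mul_assoc, hs, Units.val_mul, map_mul]
  | inv u _ hu =>
    obtain ⟨d, x, r, hx, hr⟩ := hu
    refine ⟨-d, x⁻¹, r⁻¹, hx.inv, ?_⟩
    have h1 : (x : CliffordAlgebra Q) * reverse (x : CliffordAlgebra Q) = algebraMap R _ r := by
      rw [← x.mul_left_inj, mul_assoc, hr, Algebra.commutes]
    have h2 : reverse (↑x⁻¹ : CliffordAlgebra Q) * reverse (x : CliffordAlgebra Q) = 1 := by
      rw [← reverse.map_mul, Units.mul_inv, reverse.map_one]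
    have h3 : algebraMap R (CliffordAlgebra Q) r * algebraMap R (CliffordAlgebra Q) ↑r⁻¹ = 1 := by
      rw [← map_mul, Units.mul_inv, map_one]
    calc reverse (↑x⁻¹ : CliffordAlgebra Q) * ↑x⁻¹
        = reverse (↑x⁻¹ : CliffordAlgebra Q) * ↑x⁻¹ *
          (x * reverse (x : CliffordAlgebra Q) * algebraMap R _ ↑r⁻¹) := by rw [h1, h3, mul_one]
      _ = reverse (↑x⁻¹ : CliffordAlgebra Q) * (↑x⁻¹ * x) * reverse (x : CliffordAlgebra Q) *
          algebraMap R _ ↑r⁻¹ := by simp only [mul_assoc]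
      _ = algebraMap R _ ↑r⁻¹ := by rw [Units.inv_mul, mul_one, h2, one_mul]

/-- If units have square roots, then a lift can be chosen of spinor norm one. -/
theorem exists_isGradedLift_reverse_mul_eq_one {u : orthogonalGroup Q}
    (hR : ∀ r : Rˣ, ∃ s : Rˣ, s * s = r) (hu : u ∈ reflectionSubgroup Q) :
    ∃ (d : ZMod 2) (x : (CliffordAlgebra Q)ˣ), IsGradedLift Q d x u ∧
      reverse (x : CliffordAlgebra Q) * x = 1 := by
  obtain ⟨d, x, r, hx, hr⟩ := exists_isGradedLift hu
  obtain ⟨s, hs⟩ := hR r⁻¹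
  refine ⟨d, _, hx.smul s, ?_⟩
  change reverse (algebraMap R (CliffordAlgebra Q) s * (x : CliffordAlgebra Q)) *
    (algebraMap R (CliffordAlgebra Q) s * (x : CliffordAlgebra Q)) = 1
  rw [← Algebra.smul_def, map_smul, smul_mul_smul_comm, hr, ← Units.val_mul, hs,
    Algebra.smul_def, ← map_mul, Units.inv_mul, map_one]

theorem reverse_mul_self_mul {x y : CliffordAlgebra Q} (hx : reverse x * x = 1)
    (hy : reverse y * y = 1) : reverse (x * y) * (x * y) = 1 := by
  rw [reverse.map_mul, mul_assoc, ← mul_assoc (reverse x), hx, one_mul, hy]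

theorem reverse_mul_self_inv {x : (CliffordAlgebra Q)ˣ}
    (hx : reverse (x : CliffordAlgebra Q) * x = 1) :
    reverse (↑x⁻¹ : CliffordAlgebra Q) * ↑x⁻¹ = 1 := by
  rw [← Units.eq_inv_of_mul_eq_one_right hx, reverse_reverse,
    Units.eq_inv_of_mul_eq_one_right hx, Units.mul_inv]

end GradedLift

/-! ### Base change of forms, Clifford algebras and lifts -/

section BaseChange

open CliffordAlgebra QuadraticMap

variable {Z : Type*} [CommRing Z] {Λ : Type*} [AddCommGroup Λ] [Module Z Λ]
theorem isNondegenerate_of_polar_eq_ite {ι : Type*} [Fintype ι] [DecidableEq ι]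
    {Q : QuadraticForm Z Λ} (b : Module.Basis ι Z Λ) (e : ι → Λ)
    (he : ∀ i j, polar Q (b i) (e j) = if i = j then 1 else 0) : IsNondegenerate Q := by
  constructor
  · rw [injective_iff_map_eq_zero]
    intro x hx
    refine b.ext_elem fun j => ?_
    have h : Q.polarBilin x (e j) = 0 := by rw [hx, LinearMap.zero_apply]
    conv_lhs at h => rw [← b.sum_repr x, map_sum, LinearMap.sum_apply]
    simpa [he] using h
  · intro d
    refine ⟨∑ i, d (b i) • e i, b.ext fun j => ?_⟩
    rw [map_sum, LinearMap.sum_apply]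
    simp [polar_comm Q (e _) (b j), he]

section

variable [Module.Free Z Λ]

theorem polar_extendScalars_tmul (A : Type*) [CommRing A] [Algebra Z A] (Q : QuadraticForm Z Λ)
    (a : A) (m n : Λ) :
    polar (extendScalars A Q) (a ⊗ₜ m) (1 ⊗ₜ n) = a * algebraMap Z A (polar Q m n) := by
  have h : (a ⊗ₜ[Z] m : A ⊗[Z] Λ) = a • (1 ⊗ₜ m) := by
    rw [TensorProduct.smul_tmul', smul_eq_mul, mul_one]
  rw [h, polar_smul_left, smul_eq_mul]
  simp only [polar, ← TensorProduct.tmul_add, extendScalars_one_tmul, map_sub]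

/-- A basis together with its dual family for the polar form survives tensoring, and such a pair
forces nondegeneracy. -/
theorem isNondegenerate_extendScalars [Module.Finite Z Λ] (A : Type*) [CommRing A] [Algebra Z A]
    {Q : QuadraticForm Z Λ} (hQ : IsNondegenerate Q) : IsNondegenerate (extendScalars A Q) := by
  classical
  let b := Module.Free.chooseBasis Z Λ
  choose e he using fun i => hQ.2 (b.coord i)
  refine isNondegenerate_of_polar_eq_ite (b.baseChange A) (fun i => 1 ⊗ₜ e i) fun i j => ?_
  have h := LinearMap.congr_fun (he j) (b i)
  rw [polarBilin_apply_apply, polar_comm, Module.Basis.coord_apply, Module.Basis.repr_self,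
    Finsupp.single_apply] at h
  rw [Module.Basis.baseChange_apply, polar_extendScalars_tmul, h, one_mul]
  split_ifs <;> simp

end

variable {A F : Type*} [CommRing A] [Algebra Z A] [CommRing F] [Algebra Z F] [Algebra A F]
  [IsScalarTower Z A F]

variable (Z Λ A F) in
/-- The map `A ⊗ Λ → F ⊗ Λ` induced by `A → F`. -/
noncomputable def changeScalars : A ⊗[Z] Λ →ₗ[A] F ⊗[Z] Λ :=
  TensorProduct.AlgebraTensorModule.map (Algebra.linearMap A F) LinearMap.id

theorem changeScalars_tmul (a : A) (m : Λ) :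
    changeScalars Z Λ A F (a ⊗ₜ m) = algebraMap A F a ⊗ₜ m :=
  rfl

variable [Module.Free Z Λ]

theorem extendScalars_changeScalars (Q : QuadraticForm Z Λ) (x : A ⊗[Z] Λ) :
    extendScalars F Q (changeScalars Z Λ A F x) = algebraMap A F (extendScalars A Q x) := by
  have h : (QuadraticMap.restrictScalars (S := A) (extendScalars F Q)).comp (changeScalars Z Λ A F) =
      (Algebra.linearMap A F).compQuadraticMap (extendScalars A Q) := by
    refine baseChange_ext fun m => ?_
    change extendScalars F Q (changeScalars Z Λ A F (1 ⊗ₜ m)) =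
      algebraMap A F (extendScalars A Q (1 ⊗ₜ m))
    rw [changeScalars_tmul, map_one, extendScalars_one_tmul, extendScalars_one_tmul,
      ← IsScalarTower.algebraMap_apply]
  exact congrArg (fun q : QuadraticMap A (A ⊗[Z] Λ) F => q x) h

variable (A F) in
/-- The map of Clifford algebras induced by `A → F`. -/
noncomputable def cliffordChangeScalars (Q : QuadraticForm Z Λ) :
    CliffordAlgebra (extendScalars A Q) →ₐ[A] CliffordAlgebra (extendScalars F Q) :=
  CliffordAlgebra.lift _ ⟨((ι (extendScalars F Q)).restrictScalars A).comp
    (changeScalars Z Λ A F), fun m => by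
      change ι (extendScalars F Q) (changeScalars Z Λ A F m) *
        ι (extendScalars F Q) (changeScalars Z Λ A F m) = _
      rw [ι_sq_scalar, extendScalars_changeScalars, ← IsScalarTower.algebraMap_apply]⟩

theorem cliffordChangeScalars_ι (Q : QuadraticForm Z Λ) (m : A ⊗[Z] Λ) :
    cliffordChangeScalars A F Q (ι _ m) = ι _ (changeScalars Z Λ A F m) :=
  CliffordAlgebra.lift_ι_apply _ _ _

theorem cliffordChangeScalars_mem_evenOdd (Q : QuadraticForm Z Λ) {d : ZMod 2}
    {x : CliffordAlgebra (extendScalars A Q)} (hx : x ∈ evenOdd _ d) :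
    cliffordChangeScalars A F Q x ∈ evenOdd (extendScalars F Q) d := by
  induction x, hx using CliffordAlgebra.evenOdd_induction with
  | range_ι_pow v h =>
    fin_cases d
    · obtain ⟨r, rfl⟩ := Submodule.mem_one.1 h
      rw [AlgHom.commutes, IsScalarTower.algebraMap_apply A F]
      exact SetLike.algebraMap_mem_graded (evenOdd (extendScalars F Q)) _
    · change v ∈ _ ^ 1 at h
      rw [pow_one] at h
      obtain ⟨m, rfl⟩ := h
      rw [cliffordChangeScalars_ι]
      exact ι_mem_evenOdd_one _ _
  | add x y _ _ hx hy => rw [map_add]; exact Submodule.add_mem _ hx hy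
  | ι_mul_ι_mul m n x _ hx =>
    rw [map_mul, map_mul, cliffordChangeScalars_ι, cliffordChangeScalars_ι]
    have := SetLike.mul_mem_graded (ι_mul_ι_mem_evenOdd_zero (extendScalars F Q)
      (changeScalars Z Λ A F m) (changeScalars Z Λ A F n)) hx
    rwa [zero_add] at this

theorem cliffordChangeScalars_reverse (Q : QuadraticForm Z Λ)
    (x : CliffordAlgebra (extendScalars A Q)) :
    cliffordChangeScalars A F Q (reverse x) = reverse (cliffordChangeScalars A F Q x) := by
  induction x using CliffordAlgebra.induction with
  | algebraMap r =>
    rw [reverse.commutes, AlgHom.commutes, IsScalarTower.algebraMap_apply A F, reverse.commutes]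
  | ι m => rw [reverse_ι, cliffordChangeScalars_ι, reverse_ι]
  | mul x y hx hy => rw [reverse.map_mul, map_mul, map_mul, reverse.map_mul, hx, hy]
  | add x y hx hy => rw [map_add, map_add, map_add, map_add, hx, hy]

/-- The lifting identity is `F`-linear in the vector, so it suffices to transport it for vectors `1
⊗ m`. This carries one lift over `A` to both fields with its degree. -/
theorem IsGradedLift.changeScalars {Q : QuadraticForm Z Λ} {d : ZMod 2}
    {x : (CliffordAlgebra (extendScalars A Q))ˣ} {u : orthogonalGroup Q}
    (hx : IsGradedLift _ d x (orthogonalMap A Q u)) :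
    IsGradedLift (extendScalars F Q) d (Units.map (cliffordChangeScalars A F Q).toMonoidHom x)
      (orthogonalMap F Q u) := by
  rw [isGradedLift_iff] at *
  refine ⟨cliffordChangeScalars_mem_evenOdd Q hx.1, fun v => ?_⟩
  change _ * cliffordChangeScalars A F Q (x : CliffordAlgebra _) =
    _ * (cliffordChangeScalars A F Q (x : CliffordAlgebra _) * _)
  induction v using TensorProduct.induction_on with
  | zero => simp
  | add v w hv hw => simp only [map_add, add_mul, mul_add, hv, hw]
  | tmul c m =>
    have h := congrArg (cliffordChangeScalars A F Q) (hx.2 (1 ⊗ₜ m))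
    change cliffordChangeScalars A F Q (ι _ (1 ⊗ₜ u.1 m) * (x : CliffordAlgebra _)) = _ at h
    simp only [map_mul, map_pow, map_neg, map_one, cliffordChangeScalars_ι,
      changeScalars_tmul] at h
    have hc : ∀ n : Λ, (c ⊗ₜ[Z] n : F ⊗[Z] Λ) = c • (1 ⊗ₜ n) := fun n => by
      rw [TensorProduct.smul_tmul', smul_eq_mul, mul_one]
    change ι _ (c ⊗ₜ u.1 m) * _ = _
    rw [hc, hc, map_smul, map_smul, smul_mul_assoc, h, mul_smul_comm, mul_smul_comm]

end BaseChange

/-! ### The local ring between `ℤ_p` and the two algebraic closures -/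

section IntegralClosure

open Polynomial

variable {Z : Type*} [CommRing Z] {K : Type*} [Field K] [Algebra Z K] [IsAlgClosed K]

/-- A root in `K` is integral over the integral closure, hence over `Z`. -/
theorem exists_aeval_integralClosure_eq_zero {f : (integralClosure Z K)[X]} (hf : f.Monic)
    (hd : f.degree ≠ 0) : ∃ x, f.eval x = 0 := by
  obtain ⟨z, hz⟩ := IsAlgClosed.exists_aeval_eq_zero K f hd
  have hint : IsIntegral (integralClosure Z K) z := ⟨f, hf, hz⟩
  have hz' : z ∈ integralClosure Z K := isIntegral_trans (R := Z) z hint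
  refine ⟨⟨z, hz'⟩, Subtype.val_injective ?_⟩
  change algebraMap (integralClosure Z K) K _ = 0
  rw [← hz, aeval_def, ← eval_map, ← eval_map_apply (algebraMap (integralClosure Z K) K)]
  rfl

/-- Monic polynomials lift to monic ones, which have roots; so the residue field is algebraically
closed. -/
theorem infinite_quotient_integralClosure (m : Ideal (integralClosure Z K)) [m.IsMaximal] :
    Infinite (integralClosure Z K ⧸ m) := by
  let _ : Field (integralClosure Z K ⧸ m) := Ideal.Quotient.field m
  have : IsAlgClosed (integralClosure Z K ⧸ m) := by
    refine IsAlgClosed.of_exists_root _ fun f hf hirr => ?_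
    obtain ⟨g, hg, hdeg, hmon⟩ := lifts_and_degree_eq_and_monic
      (map_surjective _ (Ideal.Quotient.mk_surjective (I := m)) f) hf
    obtain ⟨x, hx⟩ := exists_aeval_integralClosure_eq_zero hmon
      (by rw [hdeg]; exact (degree_pos_of_irreducible hirr).ne')
    refine ⟨Ideal.Quotient.mk m x, ?_⟩
    rw [← hg, eval_map_apply, hx, map_zero]
  exact IsAlgClosed.instInfinite

theorem exists_mul_self_eq_of_localization (m : Ideal (integralClosure Z K)) [m.IsPrime]
    (r : (Localization.AtPrime m)ˣ) : ∃ s : (Localization.AtPrime m)ˣ, s * s = r := by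
  obtain ⟨a, b, hab⟩ := IsLocalization.exists_mk'_eq m.primeCompl (r : Localization.AtPrime m)
  -- The square root of `a / b` is `z / b` with `z ^ 2 = a * b`, which makes the equation monic.
  obtain ⟨z, hz⟩ := exists_aeval_integralClosure_eq_zero
    (f := X ^ 2 - C (a * (b : integralClosure Z K))) (monic_X_pow_sub_C _ two_ne_zero)
    (by rw [degree_X_pow_sub_C (by norm_num)]; norm_num)
  rw [eval_sub, eval_pow, eval_X, eval_C, sub_eq_zero] at hz
  have hs : IsLocalization.mk' (Localization.AtPrime m) z b *
      IsLocalization.mk' (Localization.AtPrime m) z b = r := by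
    rw [← IsLocalization.mk'_mul, ← hab, IsLocalization.mk'_eq_iff_eq]
    congr 1
    rw [Submonoid.coe_mul]
    linear_combination (b : integralClosure Z K) * hz
  have hu : IsUnit (IsLocalization.mk' (Localization.AtPrime m) z b) :=
    isUnit_of_mul_isUnit_left (hs ▸ r.isUnit)
  exact ⟨hu.unit, Units.ext hs⟩

end IntegralClosure

theorem nonempty_algHom_of_isAlgebraic (F E k : Type*) [Field F] [Field E] [Algebra F E]
    [Algebra.IsAlgebraic F E] [Field k] [IsAlgClosed k] [Algebra F k] :
    Nonempty (E →ₐ[F] k) :=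
  ⟨IsAlgClosed.lift⟩

/-- Between `ℤ_p` and its fraction field's algebraic closure there is a local ring with infinite
residue field and square roots of units that maps to the algebraic closure of `𝔽_p`. -/
theorem exists_local_ring (p : ℕ) [Fact p.Prime]
    (K : Type*) [Field K] [Algebra ℚ_[p] K] [IsAlgClosure ℚ_[p] K]
    [Algebra ℤ_[p] K] [IsScalarTower ℤ_[p] ℚ_[p] K]
    (k : Type*) [Field k] [Algebra (ZMod p) k] [IsAlgClosure (ZMod p) k]
    [Algebra ℤ_[p] k]
    (hk : ∀ a : ℤ_[p], algebraMap ℤ_[p] k a = algebraMap (ZMod p) k (PadicInt.toZMod a)) :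
    ∃ (m : Ideal (integralClosure ℤ_[p] K)) (_ : m.IsMaximal)
      (i : Localization.AtPrime m →ₐ[ℤ_[p]] K), Function.Injective i ∧
      Nonempty (Localization.AtPrime m →ₐ[ℤ_[p]] k) := by
  have : IsAlgClosed k := IsAlgClosure.isAlgClosed (ZMod p)
  obtain ⟨m, hm⟩ := Ideal.exists_maximal (integralClosure ℤ_[p] K)
  let _ : Field (integralClosure ℤ_[p] K ⧸ m) := Ideal.Quotient.field m
  let φ : ℤ_[p] →+* integralClosure ℤ_[p] K ⧸ m := algebraMap _ _
  -- By integrality `m` lies over the maximal ideal of `ℤ_p`, so its residue field is an extension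
  -- of `𝔽_p`; it is algebraic and therefore embeds in `k`.
  have hcomap : m.comap (algebraMap ℤ_[p] (integralClosure ℤ_[p] K)) =
      IsLocalRing.maximalIdeal ℤ_[p] :=
    IsLocalRing.eq_maximalIdeal (Ideal.isMaximal_comap_of_isIntegral_of_isMaximal m)
  have hker : RingHom.ker (PadicInt.toZMod (p := p)) ≤ RingHom.ker φ := by
    rw [PadicInt.ker_toZMod, ← hcomap]
    exact fun a ha => Ideal.Quotient.eq_zero_iff_mem.2 ha
  let ψ : ZMod p →+* integralClosure ℤ_[p] K ⧸ m :=
    RingHom.liftOfSurjective (PadicInt.toZMod (p := p)) (ZMod.ringHom_surjective _) ⟨φ, hker⟩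
  have hψ : ∀ a, ψ (PadicInt.toZMod a) = φ a := fun a =>
    RingHom.liftOfRightInverse_comp_apply _ _ _ ⟨φ, hker⟩ a
  let _ : Algebra (ZMod p) (integralClosure ℤ_[p] K ⧸ m) := ψ.toAlgebra
  have halg : Algebra.IsAlgebraic (ZMod p) (integralClosure ℤ_[p] K ⧸ m) := by
    refine ⟨fun x => IsIntegral.isAlgebraic ?_⟩
    obtain ⟨y, rfl⟩ := Ideal.Quotient.mk_surjective x
    obtain ⟨q, hq, hy⟩ := integralClosure.isIntegral y
    refine ⟨q.map PadicInt.toZMod, hq.map _, ?_⟩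
    have hc : ψ.comp PadicInt.toZMod = φ := RingHom.ext hψ
    change Polynomial.eval₂ ψ _ _ = 0
    rw [Polynomial.eval₂_map, hc]
    have := congrArg (Ideal.Quotient.mk m) hy
    rwa [Polynomial.hom_eval₂, map_zero] at this
  obtain ⟨π₀⟩ : Nonempty ((integralClosure ℤ_[p] K ⧸ m) →ₐ[ZMod p] k) :=
    nonempty_algHom_of_isAlgebraic (ZMod p) _ k
  let f : integralClosure ℤ_[p] K →ₐ[ℤ_[p]] k :=
    { π₀.toRingHom.comp (Ideal.Quotient.mk m) with
      commutes' := fun a => by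
        change π₀ (φ a) = _
        rw [hk, ← hψ]
        exact π₀.commutes _ }
  have hf : ∀ y : m.primeCompl, IsUnit (f y) := fun y => by
    refine isUnit_iff_ne_zero.2 fun h => y.2 ?_
    exact Ideal.Quotient.eq_zero_iff_mem.1 ((map_eq_zero π₀).1 h)
  have hg : ∀ y : m.primeCompl, IsUnit ((integralClosure ℤ_[p] K).val y) := fun y => by
    refine isUnit_iff_ne_zero.2 fun h => y.2 ?_
    have h0 : (y : integralClosure ℤ_[p] K) = 0 := Subtype.val_injective h
    rw [h0]
    exact m.zero_mem
  refine ⟨m, hm, IsLocalization.liftAlgHom hg, ?_, ⟨IsLocalization.liftAlgHom hf⟩⟩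
  rw [injective_iff_map_eq_zero]
  intro x hx
  obtain ⟨a, b, rfl⟩ := IsLocalization.exists_mk'_eq m.primeCompl x
  rw [IsLocalization.liftAlgHom_apply, IsLocalization.lift_mk', Units.mul_left_eq_zero] at hx
  have h0 : a = 0 := Subtype.val_injective hx
  rw [h0, IsLocalization.mk'_zero]

theorem infinite_residueField_localization {A : Type*} [CommRing A] (m : Ideal A) [m.IsMaximal]
    [Infinite (A ⧸ m)] : Infinite (IsLocalRing.ResidueField (Localization.AtPrime m)) :=
  Infinite.of_injective _
    (IsLocalization.AtPrime.equivQuotMaximalIdeal m (Localization.AtPrime m)).injective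

/-! ### Explicit cocycles and coboundaries in degrees 1 and 2 -/

section Cochains

open CategoryTheory TopRep

universe u

variable {Γ : Type u} [Group Γ] [TopologicalSpace Γ] [IsTopologicalGroup Γ]

theorem iCycles_injective (n : ℕ) :
    Function.Injective ((homogeneousCochains (trivialF₂ Γ)).iCycles n).hom :=
  (ModuleCat.mono_iff_injective ((forget₂ (TopModuleCat (ZMod 2)) (ModuleCat (ZMod 2))).map
    ((homogeneousCochains (trivialF₂ Γ)).iCycles n))).1 inferInstance

/-- The abstract cocycle object receives a map from the concrete kernel of the differential. -/
theorem exists_cocycle (n : ℕ) (x : (homogeneousCochains (trivialF₂ Γ)).X n)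
    (hx : ((homogeneousCochains (trivialF₂ Γ)).d n (n + 1)).hom x = 0) :
    ∃ y : ContinuousCohomology.cocycles (trivialF₂ Γ) n,
      ((homogeneousCochains (trivialF₂ Γ)).iCycles n).hom y = x := by
  have h := (homogeneousCochains (trivialF₂ Γ)).liftCycles_i
    (TopModuleCat.kerι ((homogeneousCochains (trivialF₂ Γ)).d n (n + 1))) (n + 1) (by simp)
    (TopModuleCat.kerι_comp _)
  let x' : TopModuleCat.ker ((homogeneousCochains (trivialF₂ Γ)).d n (n + 1)) := ⟨x, hx⟩
  exact ⟨_, congrArg (fun f => TopModuleCat.Hom.hom f x') h⟩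

theorem π_eq_of_eq_add_d (n : ℕ) {y y' : ContinuousCohomology.cocycles (trivialF₂ Γ) (n + 1)}
    {x : (homogeneousCochains (trivialF₂ Γ)).X n}
    (hx : ((homogeneousCochains (trivialF₂ Γ)).iCycles (n + 1)).hom y' =
      ((homogeneousCochains (trivialF₂ Γ)).iCycles (n + 1)).hom y +
        ((homogeneousCochains (trivialF₂ Γ)).d n (n + 1)).hom x) :
    (ContinuousCohomology.π (trivialF₂ Γ) (n + 1)).hom y' =
      (ContinuousCohomology.π (trivialF₂ Γ) (n + 1)).hom y := by
  have h1 := congrArg (fun f => TopModuleCat.Hom.hom f x)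
    ((homogeneousCochains (trivialF₂ Γ)).toCycles_i n (n + 1))
  have h2 := congrArg (fun f => TopModuleCat.Hom.hom f x)
    ((homogeneousCochains (trivialF₂ Γ)).toCycles_comp_homologyπ n (n + 1))
  have h3 : y' = y + ((homogeneousCochains (trivialF₂ Γ)).toCycles n (n + 1)).hom x := by
    refine iCycles_injective (n + 1) ?_
    rw [hx, map_add]
    exact congrArg _ h1.symm
  rw [h3, map_add]
  exact (congrArg _ h2).trans (add_zero _)

theorem d₁_apply (x : (homogeneousCochains (trivialF₂ Γ)).X 1) (g₀ g₁ g₂ : Γ) :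
    cochain₂ (((homogeneousCochains (trivialF₂ Γ)).d 1 2).hom x) g₀ g₁ g₂ =
      cochain₁ x g₁ g₂ - (cochain₁ x g₀ g₂ - cochain₁ x g₀ g₁) := by
  simp only [cochain₂]
  rw [homogeneousCochains.d_apply]
  rfl

theorem d₁_eq_zero_iff (x : (homogeneousCochains (trivialF₂ Γ)).X 1) :
    ((homogeneousCochains (trivialF₂ Γ)).d 1 2).hom x = 0 ↔ ∀ g₀ g₁ g₂ : Γ,
      cochain₁ x g₁ g₂ - (cochain₁ x g₀ g₂ - cochain₁ x g₀ g₁) = 0 := by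
  simp only [← d₁_apply]
  refine ⟨fun h g₀ g₁ g₂ => by rw [h]; rfl, fun h => Subtype.ext ?_⟩
  exact ContinuousMap.ext fun g₀ => ContinuousMap.ext fun g₁ => ContinuousMap.ext fun g₂ =>
    h g₀ g₁ g₂

theorem d₂_eq_zero_iff (x : (homogeneousCochains (trivialF₂ Γ)).X 2) :
    ((homogeneousCochains (trivialF₂ Γ)).d 2 3).hom x = 0 ↔ ∀ g₀ g₁ g₂ g₃ : Γ,
      cochain₂ x g₁ g₂ g₃ - (cochain₂ x g₀ g₂ g₃ -
        (cochain₂ x g₀ g₁ g₃ - cochain₂ x g₀ g₁ g₂)) = 0 := by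
  have key : ∀ g₀ g₁ g₂ g₃ : Γ,
      (show C(Γ, C(Γ, C(Γ, C(Γ, ULift.{u} (ZMod 2))))) from
        (((homogeneousCochains (trivialF₂ Γ)).d 2 3).hom x).1) g₀ g₁ g₂ g₃ =
      cochain₂ x g₁ g₂ g₃ - (cochain₂ x g₀ g₂ g₃ -
        (cochain₂ x g₀ g₁ g₃ - cochain₂ x g₀ g₁ g₂)) := fun g₀ g₁ g₂ g₃ => by
    rw [homogeneousCochains.d_apply]
    rfl
  simp only [← key]
  refine ⟨fun h g₀ g₁ g₂ g₃ => by rw [h]; rfl, fun h => Subtype.ext ?_⟩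
  exact ContinuousMap.ext fun g₀ => ContinuousMap.ext fun g₁ => ContinuousMap.ext fun g₂ =>
    ContinuousMap.ext fun g₃ => h g₀ g₁ g₂ g₃

theorem exists_cochain₁ {f : Γ → ZMod 2} (hf : Continuous f) :
    ∃ x : (homogeneousCochains (trivialF₂ Γ)).X 1,
      ∀ g₀ g₁, (cochain₁ x g₀ g₁).down = f (g₀⁻¹ * g₁) := by
  let F : C(Γ × Γ, ULift.{u} (ZMod 2)) :=
    ⟨fun p => ULift.up (f (p.1⁻¹ * p.2)), continuous_uliftUp.comp (by fun_prop)⟩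
  refine ⟨⟨F.curry, fun g => ?_⟩, fun g₀ g₁ => rfl⟩
  refine ContinuousMap.ext fun g₀ => ContinuousMap.ext fun g₁ => ?_
  change ULift.up (f ((g⁻¹ * g₀)⁻¹ * (g⁻¹ * g₁))) = ULift.up (f (g₀⁻¹ * g₁))
  congr 2
  group

theorem exists_cochain₂ {z : Γ → Γ → ZMod 2} (hz : Continuous fun p : Γ × Γ => z p.1 p.2) :
    ∃ x : (homogeneousCochains (trivialF₂ Γ)).X 2,
      ∀ g₀ g₁ g₂, (cochain₂ x g₀ g₁ g₂).down = z (g₀⁻¹ * g₁) (g₁⁻¹ * g₂) := by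
  let F : C((Γ × Γ) × Γ, ULift.{u} (ZMod 2)) :=
    ⟨fun p => ULift.up (z (p.1.1⁻¹ * p.1.2) (p.1.2⁻¹ * p.2)),
      continuous_uliftUp.comp (hz.comp (f := fun p : (Γ × Γ) × Γ =>
        (p.1.1⁻¹ * p.1.2, p.1.2⁻¹ * p.2)) (by fun_prop))⟩
  refine ⟨⟨F.curry.curry, fun g => ?_⟩, fun g₀ g₁ g₂ => rfl⟩
  refine ContinuousMap.ext fun g₀ => ContinuousMap.ext fun g₁ => ContinuousMap.ext fun g₂ => ?_
  change ULift.up (z ((g⁻¹ * g₀)⁻¹ * (g⁻¹ * g₁)) ((g⁻¹ * g₁)⁻¹ * (g⁻¹ * g₂))) =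
    ULift.up (z (g₀⁻¹ * g₁) (g₁⁻¹ * g₂))
  congr 2 <;> group

theorem exists_represents₁ {χ : Γ → ZMod 2} (hχ : Continuous χ)
    (hmul : ∀ σ τ, χ (σ * τ) = χ σ + χ τ) : ∃ c : H Γ 1, Represents₁ χ c := by
  obtain ⟨x, hx⟩ := exists_cochain₁ hχ
  obtain ⟨y, rfl⟩ := exists_cocycle 1 x ((d₁_eq_zero_iff x).2 fun g₀ g₁ g₂ => ULift.ext _ _ (by
    change (cochain₁ x g₁ g₂).down - ((cochain₁ x g₀ g₂).down - (cochain₁ x g₀ g₁).down) = 0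
    rw [hx, hx, hx, show g₀⁻¹ * g₂ = g₀⁻¹ * g₁ * (g₁⁻¹ * g₂) by group, hmul (g₀⁻¹ * g₁)]
    abel))
  exact ⟨_, y, hx, rfl⟩

theorem Represents₁.unique {χ : Γ → ZMod 2} {c c' : H Γ 1} (h : Represents₁ χ c)
    (h' : Represents₁ χ c') : c = c' := by
  obtain ⟨y, hy, rfl⟩ := h
  obtain ⟨y', hy', rfl⟩ := h'
  congr 1
  refine iCycles_injective 1 (Subtype.ext ?_)
  exact ContinuousMap.ext fun g₀ => ContinuousMap.ext fun g₁ => ULift.ext _ _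
    ((hy g₀ g₁).trans (hy' g₀ g₁).symm)

theorem exists_represents₂ {z : Γ → Γ → ZMod 2} (hz : Continuous fun p : Γ × Γ => z p.1 p.2)
    (hcoc : ∀ σ τ υ, z σ τ + z (σ * τ) υ = z σ (τ * υ) + z τ υ) :
    ∃ c : H Γ 2, Represents₂ z c := by
  obtain ⟨x, hx⟩ := exists_cochain₂ hz
  obtain ⟨y, rfl⟩ := exists_cocycle 2 x ((d₂_eq_zero_iff x).2 fun g₀ g₁ g₂ g₃ => ULift.ext _ _ (by
    change (cochain₂ x g₁ g₂ g₃).down - ((cochain₂ x g₀ g₂ g₃).down -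
      ((cochain₂ x g₀ g₁ g₃).down - (cochain₂ x g₀ g₁ g₂).down)) = 0
    have h := hcoc (g₀⁻¹ * g₁) (g₁⁻¹ * g₂) (g₂⁻¹ * g₃)
    rw [show g₀⁻¹ * g₁ * (g₁⁻¹ * g₂) = g₀⁻¹ * g₂ by group,
      show g₁⁻¹ * g₂ * (g₂⁻¹ * g₃) = g₁⁻¹ * g₃ by group] at h
    rw [hx, hx, hx, hx]
    linear_combination -h))
  exact ⟨_, y, hx, rfl⟩

/-- Cohomologous 2-cocycles represent the same class. -/
theorem Represents₂.eq_of_coboundary {z z' : Γ → Γ → ZMod 2} {f : Γ → ZMod 2} {c c' : H Γ 2}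
    (hf : Continuous f) (hzz' : ∀ σ τ, z' σ τ = z σ τ + (f σ + f τ - f (σ * τ)))
    (h : Represents₂ z c) (h' : Represents₂ z' c') : c' = c := by
  obtain ⟨y, hy, rfl⟩ := h
  obtain ⟨y', hy', rfl⟩ := h'
  obtain ⟨x, hx⟩ := exists_cochain₁ hf
  refine π_eq_of_eq_add_d 1 (x := x) (Subtype.ext ?_)
  refine ContinuousMap.ext fun g₀ => ContinuousMap.ext fun g₁ => ContinuousMap.ext fun g₂ =>
    ULift.ext _ _ ((hy' g₀ g₁ g₂).trans ?_)
  change _ = (cochain₂ _ g₀ g₁ g₂).down + (cochain₂ (((homogeneousCochains (trivialF₂ Γ)).d 1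
    2).hom x) g₀ g₁ g₂).down
  rw [hy, d₁_apply]
  change _ = _ + ((cochain₁ x g₁ g₂).down - ((cochain₁ x g₀ g₂).down - (cochain₁ x g₀ g₁).down))
  rw [hzz', hx, hx, hx, show g₀⁻¹ * g₂ = g₀⁻¹ * g₁ * (g₁⁻¹ * g₂) by group]
  abel

end Cochains

/-! ### Scalars and signs in the Clifford algebra -/

section CliffordScalars

open CliffordAlgebra

variable {R : Type*} [CommRing R] {M : Type*} [AddCommGroup M] [Module R M] [Module.Free R M]

/-- On a free module `Q` comes from a bilinear form, not necessarily symmetric, so `changeForm` maps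
to the exterior algebra without inverting 2; there the scalars split off. -/
theorem clifford_algebraMap_injective (Q : QuadraticForm R M) :
    Function.Injective (algebraMap R (CliffordAlgebra Q)) := by
  obtain ⟨B, hB⟩ := LinearMap.BilinMap.toQuadraticMap_surjective (-Q)
  have hB' : B.toQuadraticMap = 0 - Q := hB.trans (zero_sub Q).symm
  intro r s h
  have h' := congrArg (changeForm hB') h
  rw [changeForm_algebraMap, changeForm_algebraMap] at h'
  exact (ExteriorAlgebra.algebraMap_leftInverse M).injective h'

theorem clifford_nontrivial [Nontrivial R] (Q : QuadraticForm R M) :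
    Nontrivial (CliffordAlgebra Q) :=
  (clifford_algebraMap_injective Q).nontrivial

theorem clifford_units_neg_one_ne_one (Q : QuadraticForm R M) (h2 : (2 : R) ≠ 0) :
    (-1 : (CliffordAlgebra Q)ˣ) ≠ 1 := by
  intro h
  have h' : algebraMap R (CliffordAlgebra Q) (-1) = algebraMap R _ 1 := by
    rw [map_neg, map_one]
    exact congrArg Units.val h
  have h'' := clifford_algebraMap_injective Q h'
  refine h2 ?_
  linear_combination -h''

variable [Module.Finite R M] [IsDomain R] {Q : QuadraticForm R M}

/-- The group `Pin~` is an extension of the orthogonal group by `±1`. -/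
theorem IsGradedLift.exists_eq_neg_one_pow (hQ : IsNondegenerate Q) {d : ZMod 2}
    {x : (CliffordAlgebra Q)ˣ} (hx : IsGradedLift Q d x 1)
    (hr : reverse (x : CliffordAlgebra Q) * x = 1) : ∃ a : ZMod 2, x = (-1) ^ a.val := by
  obtain ⟨r, h⟩ := hx.exists_eq_algebraMap hQ
  rw [h, reverse.commutes, ← map_mul, ← map_one (algebraMap R (CliffordAlgebra Q))] at hr
  rcases mul_self_eq_one_iff.1 (clifford_algebraMap_injective Q hr) with rfl | rfl
  · exact ⟨0, Units.ext (by rw [h, ZMod.val_zero, pow_zero, map_one, Units.val_one])⟩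
  · exact ⟨1, Units.ext (by
      rw [h, ZMod.val_one, pow_one, map_neg, map_one, Units.val_neg, Units.val_one])⟩

end CliffordScalars

/-! ### Sign cocycles of lifts and their dependence on the lift -/

section Cocycle

variable {G U : Type*} [Group G] [Group U] [HasDistribNeg U]

/-- This is associativity of `s σ * s τ * s υ`, with signs central and `-1 ≠ 1` so that exponents
can be compared. -/
theorem cocycle_of_lift (h : (-1 : U) ≠ 1) {s : G → U} {z : G → G → ZMod 2}
    (hz : ∀ σ τ, s σ * s τ * (s (σ * τ))⁻¹ = (-1) ^ (z σ τ).val) (σ τ υ : G) :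
    z σ τ + z (σ * τ) υ = z σ (τ * υ) + z τ υ := by
  have hz' : ∀ σ τ, s σ * s τ = (-1) ^ (z σ τ).val * s (σ * τ) := fun σ τ =>
    mul_inv_eq_iff_eq_mul.1 (hz σ τ)
  refine neg_one_pow_val_injective h ?_
  have h1 : s σ * s τ * s υ = s σ * (s τ * s υ) := mul_assoc _ _ _
  rw [hz', mul_assoc, hz', hz' τ υ, ← mul_assoc (s σ), ← (commute_neg_one_pow _ (s σ)).eq,
    mul_assoc _ (s σ), hz', ← mul_assoc, ← mul_assoc σ, ← mul_assoc, mul_left_inj,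
    ← neg_one_pow_val_add, ← neg_one_pow_val_add, add_comm (z τ υ)] at h1
  exact h1

theorem cocycle_change_of_lift (h : (-1 : U) ≠ 1) {s s' : G → U} {z z' : G → G → ZMod 2}
    {f : G → ZMod 2} (hz : ∀ σ τ, s σ * s τ * (s (σ * τ))⁻¹ = (-1) ^ (z σ τ).val)
    (hz' : ∀ σ τ, s' σ * s' τ * (s' (σ * τ))⁻¹ = (-1) ^ (z' σ τ).val)
    (hs : ∀ σ, s' σ = (-1) ^ (f σ).val * s σ) (σ τ : G) :
    z' σ τ = z σ τ + (f σ + f τ - f (σ * τ)) := by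
  rw [← add_sub_assoc, eq_sub_iff_add_eq]
  refine neg_one_pow_val_injective h ?_
  have h1 := mul_inv_eq_iff_eq_mul.1 (hz' σ τ)
  rw [hs, hs, hs, mul_assoc, ← mul_assoc (s σ), ← (commute_neg_one_pow _ (s σ)).eq, mul_assoc,
    mul_inv_eq_iff_eq_mul.1 (hz σ τ), ← mul_assoc, ← mul_assoc, ← mul_assoc, mul_left_inj,
    ← neg_one_pow_val_add, ← neg_one_pow_val_add, ← neg_one_pow_val_add] at h1
  change (-1 : U) ^ (z' σ τ + f (σ * τ)).val = (-1) ^ (z σ τ + (f σ + f τ)).val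
  rw [← h1, add_comm (z σ τ)]

end Cocycle

/-! ### Computation of the Stiefel-Whitney classes from lifts -/

section StiefelWhitney

open CliffordAlgebra

universe u

variable {Γ : Type u} [Group Γ] [TopologicalSpace Γ] [IsTopologicalGroup Γ]
  {k : Type*} [Field k] {V : Type*} [AddCommGroup V] [Module k V] [Module.Finite k V]
  {Q : QuadraticForm k V}

theorem isSW₁_iff (hQ : IsNondegenerate Q) {φ : Γ →* orthogonalGroup Q} {χ : Γ → ZMod 2}
    {s : Γ → (CliffordAlgebra Q)ˣ} (hs : ∀ σ, IsGradedLift Q (χ σ) (s σ) (φ σ)) {c₀ : H Γ 1}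
    (hc₀ : Represents₁ χ c₀) (c : H Γ 1) : IsSW₁ Q φ c ↔ c = c₀ := by
  have := clifford_nontrivial Q
  refine ⟨?_, ?_⟩
  · rintro ⟨χ', hχ', hc⟩
    have h : χ' = χ := funext fun σ => by
      obtain ⟨x, hx⟩ := hχ' σ
      exact IsGradedLift.degree_unique hQ hx (hs σ)
    exact Represents₁.unique (h ▸ hc) hc₀
  · rintro rfl
    exact ⟨χ, fun σ => ⟨s σ, hs σ⟩, hc₀⟩

theorem isSW₂_iff (hQ : IsNondegenerate Q) (h2 : (2 : k) ≠ 0) {φ : Γ →* orthogonalGroup Q}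
    {s : Γ → (CliffordAlgebra Q)ˣ} (hs : IsLocallyConstant s) (hsφ : ∀ σ, IsPinLift Q (s σ) (φ σ))
    {z : Γ → Γ → ZMod 2} (hz : ∀ σ τ, s σ * s τ * (s (σ * τ))⁻¹ = (-1) ^ (z σ τ).val)
    {c₀ : H Γ 2} (hc₀ : Represents₂ z c₀) (c : H Γ 2) : IsSW₂ Q φ c ↔ c = c₀ := by
  classical
  have hne := clifford_units_neg_one_ne_one Q h2
  refine ⟨?_, ?_⟩
  · rintro (⟨-, s', z', hs', hsφ', hz', hc⟩ | ⟨h, -⟩)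
    -- Two liftings to `Pin~` differ by a sign. Writing its exponent as a function of the pair of
    -- values makes it locally constant, so its coboundary is that of a continuous cochain.
    · let F : (CliffordAlgebra Q)ˣ × (CliffordAlgebra Q)ˣ → ZMod 2 := fun p =>
        if p.1 = p.2 then 0 else 1
      have hf : ∀ σ, s' σ = (-1) ^ (F (s' σ, s σ)).val * s σ := fun σ => by
        obtain ⟨⟨d, hd⟩, hr⟩ := hsφ σ
        obtain ⟨⟨d', hd'⟩, hr'⟩ := hsφ' σ
        have hl : IsGradedLift Q (d' + -d) (s' σ * (s σ)⁻¹) 1 :=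
          mul_inv_cancel (φ σ) ▸ IsGradedLift.mul hd' (IsGradedLift.inv hd)
        obtain ⟨a, ha⟩ := hl.exists_eq_neg_one_pow hQ
          (reverse_mul_self_mul hr' (reverse_mul_self_inv hr))
        rw [mul_inv_eq_iff_eq_mul] at ha
        by_cases heq : s' σ = s σ
        · simp [F, heq]
        · have ha1 : a = 1 := by
            fin_cases a
            · exact absurd (ha.trans (one_mul _)) heq
            · rfl
          rw [ha1] at ha
          simpa only [F, heq, if_false] using ha
      exact Represents₂.eq_of_coboundary (((hs'.prodMk hs).comp F).continuous)
        (cocycle_change_of_lift hne hz hz' hf) hc₀ hc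
    · exact absurd h h2
  · rintro rfl
    exact Or.inl ⟨h2, s, z, hs, hsφ, hz, hc₀⟩

variable {Z : Type*} [CommRing Z] {Λ : Type*} [AddCommGroup Λ] [Module Z Λ] [Module.Free Z Λ]
  [Module.Finite Z Λ]

/-- Lifts of an orthogonal group over `Z` to the Clifford group over a local `Z`-algebra with square
roots of units. -/
theorem exists_lifts (A : Type*) [CommRing A] [IsLocalRing A] [IsDomain A]
    [Infinite (IsLocalRing.ResidueField A)] [Algebra Z A] (hA : ∀ r : Aˣ, ∃ s : Aˣ, s * s = r)
    {Q : QuadraticForm Z Λ} (hQ : IsNondegenerate Q) :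
    ∃ (χ : orthogonalGroup Q → ZMod 2)
      (s : orthogonalGroup Q → (CliffordAlgebra (extendScalars A Q))ˣ)
      (z : orthogonalGroup Q → orthogonalGroup Q → ZMod 2),
      (∀ σ, IsGradedLift _ (χ σ) (s σ) (orthogonalMap A Q σ)) ∧
      (∀ σ, reverse (s σ : CliffordAlgebra (extendScalars A Q)) * s σ = 1) ∧
      (∀ σ τ, χ (σ * τ) = χ σ + χ τ) ∧
      ∀ σ τ, s σ * s τ * (s (σ * τ))⁻¹ = (-1) ^ (z σ τ).val := by
  have hQA := isNondegenerate_extendScalars A hQ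
  have := clifford_nontrivial (extendScalars A Q)
  -- The lifts are chosen on the abstract group without any continuity; composing with the locally
  -- constant `ρ` makes them locally constant.
  choose χ s hs hr using fun σ : orthogonalGroup Q =>
    exists_isGradedLift_reverse_mul_eq_one (Q := extendScalars A Q)
      (u := orthogonalMap A Q σ) hA (by rw [reflectionSubgroup_eq_top hQA]; trivial)
  have hmul : ∀ σ τ, IsGradedLift _ (χ σ + χ τ) (s σ * s τ) (orthogonalMap A Q (σ * τ)) :=
    fun σ τ => by rw [map_mul]; exact (hs σ).mul (hs τ)
  choose z hz using fun σ τ => IsGradedLift.exists_eq_neg_one_pow hQA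
    (x := s σ * s τ * (s (σ * τ))⁻¹)
    (by
      have h := (hmul σ τ).mul (hs (σ * τ)).inv
      rwa [mul_inv_cancel] at h)
    (reverse_mul_self_mul (reverse_mul_self_mul (hr σ) (hr τ)) (reverse_mul_self_inv (hr (σ * τ))))
  exact ⟨χ, s, z, hs, hr, fun σ τ => (hs (σ * τ)).degree_unique hQA (hmul σ τ), hz⟩

theorem isLocallyConstant_of_isOpen_ker {G : Type*} [Group G] {ρ : Γ →* G}
    (hρ : IsOpen (ρ.ker : Set Γ)) : IsLocallyConstant ρ := by
  refine (IsLocallyConstant.iff_exists_open _).2 fun σ =>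
    ⟨(fun τ => σ⁻¹ * τ) ⁻¹' ρ.ker, hρ.preimage (continuous_const_mul _), ?_, fun τ hτ => ?_⟩
  · change σ⁻¹ * σ ∈ ρ.ker
    rw [inv_mul_cancel]
    exact one_mem _
  · have h : ρ (σ⁻¹ * τ) = 1 := hτ
    rw [map_mul, map_inv, inv_mul_eq_one] at h
    exact h.symm

/-- The map of Clifford algebras respects `reverse` and sends `-1` to `-1`, so the image of `s` is a
lifting to `Pin~` over `F` with the same `z`, whatever `F` is. -/
theorem isSW₂_extendScalars_iff {A : Type*} [CommRing A] [Algebra Z A]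
    {Q : QuadraticForm Z Λ} (hQ : IsNondegenerate Q) {ρ : Γ →* orthogonalGroup Q}
    {F : Type*} [Field F] [Algebra Z F] [Algebra A F] [IsScalarTower Z A F] (h2 : (2 : F) ≠ 0)
    {s : Γ → (CliffordAlgebra (extendScalars A Q))ˣ} (hs : IsLocallyConstant s)
    (hsρ : ∀ σ, ∃ d, IsGradedLift _ d (s σ) (orthogonalMap A Q (ρ σ)))
    (hr : ∀ σ, reverse (s σ : CliffordAlgebra (extendScalars A Q)) * s σ = 1)
    {z : Γ → Γ → ZMod 2} (hz : ∀ σ τ, s σ * s τ * (s (σ * τ))⁻¹ = (-1) ^ (z σ τ).val)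
    {c₀ : H Γ 2} (hc₀ : Represents₂ z c₀) (c : H Γ 2) :
    IsSW₂ (extendScalars F Q) ((orthogonalMap F Q).comp ρ) c ↔ c = c₀ := by
  refine isSW₂_iff (isNondegenerate_extendScalars F hQ) h2
    (hs.comp (Units.map (cliffordChangeScalars A F Q).toMonoidHom)) (fun σ => ⟨?_, ?_⟩)
    (fun σ τ => ?_) hc₀ c
  · obtain ⟨d, hd⟩ := hsρ σ
    exact ⟨d, hd.changeScalars⟩
  · have h := congrArg (cliffordChangeScalars A F Q) (hr σ)
    rwa [map_mul, cliffordChangeScalars_reverse, map_one] at h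
  · have h := congrArg (Units.map (cliffordChangeScalars A F Q).toMonoidHom) (hz σ τ)
    rw [map_mul, map_mul, map_inv, map_pow] at h
    refine h.trans (congrArg (· ^ (z σ τ).val) (Units.ext ?_))
    change cliffordChangeScalars A F Q (-1) = -1
    rw [map_neg, map_one]

/-- The Stiefel-Whitney classes of a representation over `Z` are the same over all fields over a
local `Z`-algebra with square roots of units. -/
theorem exists_isSW_iff (A : Type*) [CommRing A] [IsLocalRing A] [IsDomain A]
    [Infinite (IsLocalRing.ResidueField A)] [Algebra Z A] (hA : ∀ r : Aˣ, ∃ s : Aˣ, s * s = r)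
    {Q : QuadraticForm Z Λ} (hQ : IsNondegenerate Q)
    (ρ : Γ →* orthogonalGroup Q) (hρ : IsOpen (ρ.ker : Set Γ))
    (K : Type*) [Field K] [Algebra Z K] [Algebra A K] [IsScalarTower Z A K]
    (k : Type*) [Field k] [Algebra Z k] [Algebra A k] [IsScalarTower Z A k] :
    (∃ w : H Γ 1,
      (∀ w', IsSW₁ (extendScalars K Q) ((orthogonalMap K Q).comp ρ) w' ↔ w' = w) ∧
      (∀ w', IsSW₁ (extendScalars k Q) ((orthogonalMap k Q).comp ρ) w' ↔ w' = w)) ∧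
    ((2 : K) ≠ 0 → (2 : k) ≠ 0 → ∃ w : H Γ 2,
      (∀ w', IsSW₂ (extendScalars K Q) ((orthogonalMap K Q).comp ρ) w' ↔ w' = w) ∧
      (∀ w', IsSW₂ (extendScalars k Q) ((orthogonalMap k Q).comp ρ) w' ↔ w' = w)) := by
  obtain ⟨χ, s, z, hs, hr, hχ, hz⟩ := exists_lifts A hA hQ
  have hlc := isLocallyConstant_of_isOpen_ker hρ
  refine ⟨?_, fun h2K h2k => ?_⟩
  · obtain ⟨w, hw⟩ := exists_represents₁ (χ := χ ∘ ρ) (hlc.comp χ).continuous fun σ τ => by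
      rw [Function.comp_apply, map_mul, hχ]; rfl
    exact ⟨w, isSW₁_iff (isNondegenerate_extendScalars K hQ) (fun σ => (hs (ρ σ)).changeScalars) hw,
      isSW₁_iff (isNondegenerate_extendScalars k hQ) (fun σ => (hs (ρ σ)).changeScalars) hw⟩
  -- The cocycle identity for `z` is verified over `A`, where it needs `-1 ≠ 1`.
  · have h2A : (2 : A) ≠ 0 := fun h => h2K (by
      rw [← map_ofNat (algebraMap A K) 2, h, map_zero])
    obtain ⟨w, hw⟩ := exists_represents₂ (z := fun σ τ => z (ρ σ) (ρ τ))
      (((hlc.comp_continuous continuous_fst).prodMk (hlc.comp_continuous continuous_snd)).comp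
        fun p => z p.1 p.2).continuous fun σ τ υ => by
          have h := cocycle_of_lift (clifford_units_neg_one_ne_one (extendScalars A Q) h2A) hz
            (ρ σ) (ρ τ) (ρ υ)
          simpa only [map_mul] using h
    have hc : IsLocallyConstant (s ∘ ρ) := hlc.comp s
    have hz' : ∀ σ τ, s (ρ σ) * s (ρ τ) * (s (ρ (σ * τ)))⁻¹ = (-1) ^ (z (ρ σ) (ρ τ)).val :=
      fun σ τ => by rw [map_mul]; exact hz _ _
    exact ⟨w, isSW₂_extendScalars_iff hQ h2K hc (fun σ => ⟨_, hs (ρ σ)⟩) (fun σ => hr (ρ σ)) hz' hw,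
      isSW₂_extendScalars_iff hQ h2k hc (fun σ => ⟨_, hs (ρ σ)⟩) (fun σ => hr (ρ σ)) hz' hw⟩

end StiefelWhitney

end SWRed

/-- The Stiefel-Whitney classes of `ρ` over the algebraic closures `K` of `ℚ_p` and `k` of `𝔽_p`
exist, are uniquely determined, and agree (only the first ones if `p = 2`). -/
theorem mainTheorem5 (p : ℕ) [Fact p.Prime]
    {Λ : Type*} [AddCommGroup Λ] [Module ℤ_[p] Λ] [Module.Free ℤ_[p] Λ] [Module.Finite ℤ_[p] Λ]
    (Q : QuadraticForm ℤ_[p] Λ) (hQ : SWRed.IsNondegenerate Q)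
    {Γ : Type*} [Group Γ] [TopologicalSpace Γ] [IsTopologicalGroup Γ] [CompactSpace Γ]
    [TotallyDisconnectedSpace Γ]
    (ρ : Γ →* SWRed.orthogonalGroup Q) (hρ : IsOpen (ρ.ker : Set Γ))
    (K : Type*) [Field K] [Algebra ℚ_[p] K] [IsAlgClosure ℚ_[p] K]
    [Algebra ℤ_[p] K] [IsScalarTower ℤ_[p] ℚ_[p] K]
    (k : Type*) [Field k] [Algebra (ZMod p) k] [IsAlgClosure (ZMod p) k]
    [Algebra ℤ_[p] k]
    (hk : ∀ a : ℤ_[p], algebraMap ℤ_[p] k a = algebraMap (ZMod p) k (PadicInt.toZMod a)) :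
    (p ≠ 2 → ∃ w : SWRed.H Γ 1 × SWRed.H Γ 2,
      (∀ w', SWRed.IsSW (SWRed.extendScalars K Q) ((SWRed.orthogonalMap K Q).comp ρ) w' ↔
        w' = w) ∧
      (∀ w', SWRed.IsSW (SWRed.extendScalars k Q) ((SWRed.orthogonalMap k Q).comp ρ) w' ↔
        w' = w)) ∧
    (p = 2 → ∃ w : SWRed.H Γ 1,
      (∀ w', SWRed.IsSW₁ (SWRed.extendScalars K Q) ((SWRed.orthogonalMap K Q).comp ρ) w' ↔
        w' = w) ∧
      (∀ w', SWRed.IsSW₁ (SWRed.extendScalars k Q) ((SWRed.orthogonalMap k Q).comp ρ) w' ↔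
        w' = w)) := by
  have : IsAlgClosed K := IsAlgClosure.isAlgClosed ℚ_[p]
  obtain ⟨m, hm, i, hi, ⟨π⟩⟩ := SWRed.exists_local_ring p K k hk
  have := SWRed.infinite_quotient_integralClosure m
  have := SWRed.infinite_residueField_localization m
  have : IsDomain (Localization.AtPrime m) := hi.isDomain i.toRingHom
  let _ : Algebra (Localization.AtPrime m) K := i.toRingHom.toAlgebra
  let _ : Algebra (Localization.AtPrime m) k := π.toRingHom.toAlgebra
  have : IsScalarTower ℤ_[p] (Localization.AtPrime m) K :=
    IsScalarTower.of_algebraMap_eq fun a => (i.commutes a).symm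
  have : IsScalarTower ℤ_[p] (Localization.AtPrime m) k :=
    IsScalarTower.of_algebraMap_eq fun a => (π.commutes a).symm
  obtain ⟨h₁, h₂⟩ := SWRed.exists_isSW_iff (Localization.AtPrime m)
    (SWRed.exists_mul_self_eq_of_localization m) hQ ρ hρ K k
  refine ⟨fun hp => ?_, fun _ => h₁⟩
  obtain ⟨w₁, hK₁, hk₁⟩ := h₁
  have h2K : (2 : K) ≠ 0 := by
    rw [← map_ofNat (algebraMap ℚ_[p] K) 2]
    exact (map_ne_zero _).2 two_ne_zero
  have h2k : (2 : k) ≠ 0 := by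
    rw [← map_ofNat (algebraMap (ZMod p) k) 2]
    refine (map_ne_zero _).2 fun h => hp ?_
    have h' : ((2 : ℕ) : ZMod p) = 0 := h
    exact (Nat.prime_dvd_prime_iff_eq (Fact.out : p.Prime) Nat.prime_two).1
      ((ZMod.natCast_eq_zero_iff 2 p).1 h')
  obtain ⟨w₂, hK₂, hk₂⟩ := h₂ h2K h2k
  have hw : ∀ w' : SWRed.H Γ 1 × SWRed.H Γ 2, w' = (w₁, w₂) ↔ w'.1 = w₁ ∧ w'.2 = w₂ :=
    fun w' => Prod.ext_iff
  exact ⟨(w₁, w₂), fun w' => (and_congr (hK₁ _) (hK₂ _)).trans (hw w').symm,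
    fun w' => (and_congr (hk₁ _) (hk₂ _)).trans (hw w').symm⟩
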